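/- Let $n\ge 1$, let $p<0$ and $q>0$ be real numbers, and let $\mu=\sum_{v\in U}\alpha_v\delta_v$ be a discrete measure on the unit sphere $\mathbb S^{n-1}$ of $\mathbb R^n$, where $U\subset\mathbb S^{n-1}$ is a finite set, $\alpha_v>0$ for every $v\in U$, and $U$ is in general position, that is, $U$ is not contained in a closed hemisphere and any $n$ elements of $U$ are linearly independent. For a convex body $K\subset\mathbb R^n$ with the origin in its interior let $h_K(v)=\max_{x\in K}x\cdot v$ be its support function and, for $z\in\partial K$ and $u\in\mathbb S^{n-1}$, put $\rho_{K,z}(u)=\max\{\lambda\ge 0: z+\lambda u\in K\}$ and $$\widetilde V_{q-1}(K,z)=\frac1n\int_{\{u\in\mathbb S^{n-1}:\,\rho_{K,z}(u)>0\}}\rho_{K,z}(u)^{q-1}\,du,$$ where $du$ is spherical Lebesgue measure. Let $\nu_K(z)$ be the outer unit normal of $K$ at $z$, defined for those $z\in\partial K$ at which it is unique (that is, for $\mathcal H^{n-1}$-almost every $z\in\partial K$). The $L_p$ chord measure of $K$ is $$F_{p,q}(K,\eta)=\frac{2q}{\omega_n}\int_{\nu_K^{-1}(\eta)}\bigl(z\cdot\nu_K(z)\bigr)^{1-p}\,\widetilde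 V_{q-1}(K,z)\,d\mathcal H^{n-1}(z),\qquad \eta\subset\mathbb S^{n-1}\text{ Borel},$$ where $\omega_n$ is the volume of the unit ball of $\mathbb R^n$ and $\mathcal H^{n-1}$ is $(n-1)$-dimensional Hausdorff measure, normalized to agree with Lebesgue measure on hyperplanes. Then there exists a polytope $P$ (the convex hull of finitely many points) containing the origin in its interior, satisfying $$P=\bigcap_{v\in U}\{x\in\mathbb R^n: x\cdot v\le h_P(v)\},$$ all of whose facets have their outer unit normals in $U$, such that $F_{p,q}(P,\eta)=\mu(\eta)$ for every Borel set $\eta\subset\mathbb S^{n-1}$, that is, $F_{p,q}(P,\cdot)=\mu$. -/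

import Mathlib

open MeasureTheory Metric
open scoped ENNReal

noncomputable section

namespace ChordMinkowski

/-- Euclidean `n`-space. -/
abbrev E (n : ℕ) : Type := EuclideanSpace ℝ (Fin n)

/-- The unit sphere of Euclidean `n`-space. -/
abbrev S (n : ℕ) : Type := sphere (0 : E n) 1

variable {n : ℕ}

/-- A finite set `U` of unit vectors is in general position: it is not contained in a closed
hemisphere, and any `n` of its elements are linearly independent. -/
def InGeneralPosition (U : Finset (S n)) : Prop :=
  (¬ ∃ u : S n, ∀ v ∈ U, 0 ≤ inner ℝ (u : E n) (v : E n)) ∧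
    ∀ T ⊆ U, T.card = n → LinearIndependent ℝ (fun v : T => ((v : S n) : E n))

/-- A polytope is the convex hull of finitely many points. -/
def IsPolytope (P : Set (E n)) : Prop :=
  ∃ T : Finset (E n), P = convexHull ℝ (T : Set (E n))

/-- The support function `h_K(v) = max {x ⬝ v : x ∈ K}`. -/
def supportFun (K : Set (E n)) (v : E n) : ℝ :=
  sSup ((fun x => inner ℝ x v) '' K)

/-- The support hyperplane `H_K(v)`. -/
def supportHyperplane (K : Set (E n)) (v : S n) : Set (E n) :=
  {x | inner ℝ x (v : E n) = supportFun K v}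

/-- The supporting half-space `H⁻_K(v)`. -/
def supportHalfspace (K : Set (E n)) (v : S n) : Set (E n) :=
  {x | inner ℝ x (v : E n) ≤ supportFun K v}

/-- The unit vector `v` is the outer normal of a facet of `P`: the face `P ∩ H_P(v)` has
dimension `dim P - 1`. -/
def IsFacetNormal (P : Set (E n)) (v : S n) : Prop :=
  (P ∩ supportHyperplane P v).Nonempty ∧
    Module.finrank ℝ (vectorSpan ℝ (P ∩ supportHyperplane P v)) + 1 =
      Module.finrank ℝ (vectorSpan ℝ P)

/-- The class `𝒫(v₁, …, v_N)`, where `U = {v₁, …, v_N}`: polytopes that are the intersection of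
their supporting half-spaces in the directions of `U`. -/
def polytopeClass (U : Finset (S n)) : Set (Set (E n)) :=
  {P | IsPolytope P ∧ P = ⋂ v ∈ U, supportHalfspace P v}

/-- The spherical image `ν_K(z)` as a set: all outer unit normals of `K` at `z`. -/
def normals (K : Set (E n)) (z : E n) : Set (S n) :=
  {v | z ∈ supportHyperplane K v}

open Classical in
/-- The Gauss map `ν_K`, at the points with exactly one outer unit normal
(the value `0` elsewhere is never used). -/
def gaussMap (K : Set (E n)) (z : E n) : E n :=
  if h : ∃ v : S n, normals K z = {v} then (h.choose : E n) else 0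

/-- `ν_K⁻¹(η)`: the boundary points of `K` with exactly one outer unit normal, this normal
lying in `η`. -/
def gaussPreimage (K : Set (E n)) (η : Set (S n)) : Set (E n) :=
  {z ∈ frontier K | ∃ v ∈ η, normals K z = {v}}

/-- The radial function `ρ_{K,z}(u)` of `K` with respect to a point `z` of `K`. -/
def radialFun (K : Set (E n)) (z : E n) (u : S n) : ℝ :=
  sSup {t : ℝ | 0 ≤ t ∧ z + t • (u : E n) ∈ K}

/-- The dual quermassintegral
`Ṽ_r(K, z) = (1/n) ∫_{ρ_{K,z}(u) > 0} ρ_{K,z}(u)^r du` with respect to a point `z` of `K`,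
where `du` is spherical Lebesgue measure. -/
def dualQuermassintegral (r : ℝ) (K : Set (E n)) (z : E n) : ℝ≥0∞ :=
  (n : ℝ≥0∞)⁻¹ *
    ∫⁻ u in {u : S n | 0 < radialFun K z u}, ENNReal.ofReal (radialFun K z u ^ r)
      ∂(volume : Measure (E n)).toSphere

/-- The `L_p` chord measure
`F_{p,q}(K, η) = (2q/ω_n) ∫_{ν_K⁻¹(η)} (z ⬝ ν_K(z))^{1-p} Ṽ_{q-1}(K, z) dℋ^{n-1}(z)`,
for Borel sets `η` in the unit sphere, where `ω_n` is the volume of the unit ball and `ℋ^{n-1}` is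
Hausdorff measure, normalized to agree with Lebesgue measure on hyperplanes. -/
def lpChordMeasure (p q : ℝ) (K : Set (E n)) (η : Set (S n)) : ℝ≥0∞ :=
  ENNReal.ofReal (2 * q) / volume (ball (0 : E n) 1) *
    ∫⁻ z in gaussPreimage K η,
      ENNReal.ofReal ((inner ℝ z (gaussMap K z)) ^ (1 - p)) * dualQuermassintegral (q - 1) K z
        ∂(Measure.euclideanHausdorffMeasure (n - 1))

end ChordMinkowski

end

/-! The solution is found by a variational argument. For support numbers h on U, let P(h) be the
polytope they cut out, G(h) = ∫_S ∫_{P(h)} ρ_{P(h),x}(u)^{q-1} dx du its chord integral, and f(h) =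
∑ α_v h_v^p. With P(h) translated so that f is minimal, maximize the dilation-invariant quantity
f^{(n+q-1)/(-p)} G. A suitable dilate of the maximizer solves the problem.

Derivative of G. Reversing the chords parallel to u shows that u and -u contribute equally to G, so
G is twice the integral over the directions with u ⬝ v < 0 (`chordIntegral_eq_two_mul`). A ray in
such a direction moves away from the hyperplane with normal v, so the integrand does not involve
h_v, which survives only as the upper limit of an integral over slices orthogonal to v
(`chordIntegral_update`). By the fundamental theorem of calculus, ∂G/∂h_v is twice the integral over
the facet with normal v of the inward integral of ρ^{q-1}, which is the chord measure up to
constants and the factor h_v^{1-p}. This needs the slice integral to be continuous in the height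
(`continuousAt_sliceIntegral`); for q < 1 the integrand is unbounded near the boundary, hence
Vitali's theorem. The code uses 1/ρ, a finite maximum of quotients.

Compactness. Since p < 0, f blows up when the origin of a translate approaches the boundary, so a
best translate exists, and there ∑ α_v h_v^{p-1} v = 0. General position makes such a relation
uniformly nondegenerate (`InGeneralPosition.exists_le_mul_inner`), which bounds the polytope by a
constant times each h_v (`InGeneralPosition.exists_norm_le`). After tightening and dilation the
support numbers lie in a fixed compact set (`InGeneralPosition.exists_normalized`), and a maximizer
exists.

Euler–Lagrange equations. The best translate of a perturbed polytope is never differentiated: f is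
convex, and balance cancels the translation term in its tangent inequality, so one affine function
bounds the energy of all translates from below (`IsBalanced.energy_tangent_le`). Substituting it
gives a differentiable function of one variable with a local maximum, and its critical equation says
that the facet integral is proportional to α_v h_v^{p-1}. The two sides scale with different
degrees, so a dilation adjusts the factor to the required one. -/

noncomputable section

namespace ChordMinkowski

/-! ### Fubini along a unit vector, and integrability of negative powers of the distance to a
hyperplane -/

section Slicing

variable {V : Type*} [NormedAddCommGroup V] [InnerProductSpace ℝ V] [FiniteDimensional ℝ V]
  [MeasurableSpace V] [BorelSpace V]

/-- Fubini's theorem for the slices orthogonal to a unit vector. -/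
theorem lintegral_eq_lintegral_slices {v : V} (hv : ‖v‖ = 1) {f : V → ℝ≥0∞} (hf : Measurable f) :
    ∫⁻ x, f x = ∫⁻ t : ℝ, ∫⁻ y : (Submodule.span ℝ {v})ᗮ, f (t • v + y) := by
  have h1 := ((Submodule.span ℝ {v}).measurePreserving_measurableEquivProd (0 : V)).symm
  rw [InnerProductSpace.euclideanHausdorffMeasure_eq_volume] at h1
  rw [← h1.lintegral_comp hf]
  simp only [Submodule.measurableEquivProd_symm_apply, vadd_eq_add, add_zero]
  rw [Measure.volume_eq_prod, lintegral_prod _ (by fun_prop)]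
  rw [← (LinearIsometryEquiv.toSpanUnitSingleton v hv).measurePreserving.lintegral_comp
    (f := fun x : Submodule.span ℝ {v} => ∫⁻ y : (Submodule.span ℝ {v})ᗮ, f (x + y))]
  · simp
  · exact Measurable.lintegral_prod_right' (f := fun z : (Submodule.span ℝ {v}) ×
      (Submodule.span ℝ {v})ᗮ => f (z.1 + z.2)) (by fun_prop)

/-- The singularity t^{-a} is integrable on (0, 1] because a < 1, and is at most 1 beyond; for t ≤ 0
the truncation by `ENNReal.ofReal` gives 0. Translation invariance makes the bound independent of c.
-/
theorem lintegral_ofReal_one_div_rpow_le {a : ℝ} (ha : 0 < a) (ha1 : a < 1) :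
    ∃ C : ℝ≥0∞, C ≠ ⊤ ∧ ∀ c R : ℝ,
      ∫⁻ s in Set.Icc (-R) R, ENNReal.ofReal (1 / (c - s)) ^ a ≤ C + ENNReal.ofReal (2 * R) := by
  set ψ : ℝ → ℝ≥0∞ := fun t => ENNReal.ofReal (1 / t) ^ a with hψ
  have hψm : Measurable ψ := by fun_prop
  refine ⟨∫⁻ t in Set.Ioc 0 1, ψ t, ?_, fun c R => ?_⟩
  · have h := (intervalIntegral.intervalIntegrable_rpow' (a := 0) (b := 1) (r := -a)
      (by linarith)).1
    have h2 := h.2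
    rw [hasFiniteIntegral_iff_enorm] at h2
    refine ne_of_lt (lt_of_le_of_lt (setLIntegral_mono (by fun_prop) fun t ht => ?_) h2)
    rw [hψ, Real.enorm_of_nonneg (Real.rpow_nonneg ht.1.le _)]
    simp only
    rw [ENNReal.ofReal_rpow_of_pos (by have := ht.1; positivity), one_div,
      Real.inv_rpow ht.1.le, Real.rpow_neg ht.1.le]
  · have hle : ∀ t, ψ t ≤ (Set.Ioc (0 : ℝ) 1).indicator ψ t + 1 := by
      intro t
      by_cases ht : t ∈ Set.Ioc (0 : ℝ) 1
      · simp [ht]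
      · rw [Set.indicator_of_notMem ht, zero_add]
        refine ENNReal.rpow_le_one ?_ ha.le
        rw [ENNReal.ofReal_le_one]
        rcases le_or_gt t 0 with h0 | h0
        · exact (one_div_nonpos.mpr h0).trans zero_le_one
        · have : 1 < t := by
            by_contra h1
            exact ht ⟨h0, not_lt.mp h1⟩
          rw [div_le_one h0]; exact this.le
    calc ∫⁻ s in Set.Icc (-R) R, ψ (c - s)
        ≤ ∫⁻ s in Set.Icc (-R) R, ((Set.Ioc (0 : ℝ) 1).indicator ψ (c - s) + 1) :=
          lintegral_mono fun s => hle _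
      _ = (∫⁻ s in Set.Icc (-R) R, (Set.Ioc (0 : ℝ) 1).indicator ψ (c - s))
            + ENNReal.ofReal (2 * R) := by
          rw [lintegral_add_right _ measurable_const]
          simp only [lintegral_const, one_mul, Measure.restrict_apply MeasurableSet.univ,
            Set.univ_inter, Real.volume_Icc]
          congr 2; ring
      _ ≤ (∫⁻ s, (Set.Ioc (0 : ℝ) 1).indicator ψ (c - s)) + ENNReal.ofReal (2 * R) := by
          gcongr
          exact Measure.restrict_le_self
      _ = _ := by
          rw [lintegral_sub_left_eq_self (fun t => (Set.Ioc (0 : ℝ) 1).indicator ψ t) c,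
            lintegral_indicator measurableSet_Ioc]

/-- Negative powers of the distance to a hyperplane are integrable over balls, uniformly in the
position of the hyperplane. -/
theorem lintegral_ball_one_div_rpow_le {e : V} (he : e ≠ 0) {a : ℝ} (ha : 0 < a) (ha1 : a < 1)
    (R : ℝ) :
    ∃ C : ℝ≥0∞, C ≠ ⊤ ∧ ∀ c : ℝ,
      ∫⁻ y in ball (0 : V) R, ENNReal.ofReal (1 / (c - inner ℝ y e)) ^ a ≤ C := by
  obtain ⟨C, hC, hCle⟩ := lintegral_ofReal_one_div_rpow_le ha ha1
  have hne : 0 < ‖e‖ := norm_pos_iff.mpr he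
  set v : V := ‖e‖⁻¹ • e with hv
  have hv1 : ‖v‖ = 1 := by rw [hv, norm_smul, norm_inv, norm_norm, inv_mul_cancel₀ hne.ne']
  have hev : e = ‖e‖ • v := by rw [hv, smul_inv_smul₀ hne.ne']
  set B : ℝ≥0∞ := volume (ball (0 : (Submodule.span ℝ {v})ᗮ) R) with hB
  refine ⟨ENNReal.ofReal (1 / ‖e‖) ^ a * ((C + ENNReal.ofReal (2 * R)) * B), ?_, fun c => ?_⟩
  · refine ENNReal.mul_ne_top (ENNReal.rpow_ne_top_of_nonneg ha.le ENNReal.ofReal_ne_top)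
      (ENNReal.mul_ne_top (ENNReal.add_ne_top.mpr ⟨hC, ENNReal.ofReal_ne_top⟩) ?_)
    exact measure_ball_lt_top.ne
  rw [← lintegral_indicator measurableSet_ball, lintegral_eq_lintegral_slices hv1]
  swap
  · refine Measurable.indicator ?_ measurableSet_ball
    fun_prop
  -- In the coordinates t • v + y the integrand depends on t alone, and the ball is contained in the
  -- product of [-R, R] with a ball of the orthogonal complement.
  have key : ∀ (t : ℝ) (y : (Submodule.span ℝ {v})ᗮ),
      (ball (0 : V) R).indicator (fun y => ENNReal.ofReal (1 / (c - inner ℝ y e)) ^ a) (t • v + y)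
      ≤ (Set.Icc (-R) R).indicator (fun t => ENNReal.ofReal (1 / ‖e‖) ^ a *
          ENNReal.ofReal (1 / (c / ‖e‖ - t)) ^ a) t *
        (ball (0 : (Submodule.span ℝ {v})ᗮ) R).indicator (fun _ => 1) y := by
    intro t y
    have hyv : inner ℝ (y : V) v = 0 := by
      rw [real_inner_comm]
      exact Submodule.inner_right_of_mem_orthogonal (Submodule.mem_span_singleton_self v) y.2
    by_cases hm : t • v + (y : V) ∈ ball (0 : V) R
    · have hsq : ‖t • v + (y : V)‖ ^ 2 = t ^ 2 + ‖(y : V)‖ ^ 2 := by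
        rw [norm_add_sq_real, inner_smul_left, real_inner_comm, hyv, norm_smul, hv1]
        simp
      rw [mem_ball_zero_iff] at hm
      have hR : 0 < R := lt_of_le_of_lt (norm_nonneg _) hm
      have h1 : t ^ 2 ≤ R ^ 2 := by nlinarith [norm_nonneg (t • v + (y : V)), sq_nonneg ‖(y : V)‖]
      have h2 : ‖(y : V)‖ ^ 2 < R ^ 2 := by nlinarith [norm_nonneg (t • v + (y : V)), sq_nonneg t]
      have ht : t ∈ Set.Icc (-R) R := abs_le.mp (abs_le_of_sq_le_sq h1 hR.le)
      have hy : y ∈ ball (0 : (Submodule.span ℝ {v})ᗮ) R := by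
        rw [mem_ball_zero_iff]
        exact lt_of_pow_lt_pow_left₀ 2 hR.le h2
      rw [Set.indicator_of_mem (by rwa [mem_ball_zero_iff]), Set.indicator_of_mem ht,
        Set.indicator_of_mem hy, mul_one, ← ENNReal.mul_rpow_of_nonneg _ _ ha.le,
        ← ENNReal.ofReal_mul (by positivity)]
      apply le_of_eq
      congr 2
      have : inner ℝ (t • v + (y : V)) e = ‖e‖ * t := by
        conv_lhs => rw [hev]
        rw [inner_smul_right, inner_add_left, hyv, inner_smul_left, real_inner_self_eq_norm_sq, hv1]
        simp
      rw [this, one_div_mul_one_div]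
      congr 1
      field_simp
    · rw [Set.indicator_of_notMem hm]; exact zero_le
  calc _ ≤ ∫⁻ t : ℝ, ∫⁻ y : (Submodule.span ℝ {v})ᗮ,
        (Set.Icc (-R) R).indicator (fun t => ENNReal.ofReal (1 / ‖e‖) ^ a *
          ENNReal.ofReal (1 / (c / ‖e‖ - t)) ^ a) t *
        (ball (0 : (Submodule.span ℝ {v})ᗮ) R).indicator (fun _ => 1) y :=
        lintegral_mono fun t => lintegral_mono fun y => key t y
    _ = (∫⁻ t in Set.Icc (-R) R, ENNReal.ofReal (1 / ‖e‖) ^ a *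
          ENNReal.ofReal (1 / (c / ‖e‖ - t)) ^ a) * B := by
        have hm1 : Measurable ((ball (0 : (Submodule.span ℝ {v})ᗮ) R).indicator
            (fun _ => (1 : ℝ≥0∞))) := measurable_const.indicator measurableSet_ball
        simp_rw [lintegral_const_mul _ hm1]
        rw [lintegral_mul_const _ (Measurable.indicator (by fun_prop) measurableSet_Icc),
          lintegral_indicator measurableSet_Icc, lintegral_indicator measurableSet_ball]
        simp [hB]
    _ ≤ _ := by
        rw [lintegral_const_mul _ (by fun_prop), mul_assoc]
        gcongr
        exact hCle _ _

/-- A hyperplane is a null set. -/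
theorem volume_hyperplane_eq_zero {e : V} (he : e ≠ 0) (c : ℝ) :
    volume {y : V | inner ℝ y e = c} = 0 := by
  by_cases hne : ∃ y₀ : V, inner ℝ y₀ e = c
  · obtain ⟨y₀, hy₀⟩ := hne
    have h1 : {y : V | inner ℝ y e = c} =
        (fun y => y - y₀) ⁻¹' ((Submodule.span ℝ {e})ᗮ : Submodule ℝ V) := by
      ext y
      simp only [Set.mem_ofPred_eq, Set.mem_preimage, SetLike.mem_coe,
        Submodule.mem_orthogonal_singleton_iff_inner_left, inner_sub_left, hy₀, sub_eq_zero]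
    simp_rw [h1, sub_eq_add_neg]
    rw [measure_preimage_add_right]
    refine Measure.addHaar_submodule _ _ fun htop => he ?_
    have : e ∈ (Submodule.span ℝ {e})ᗮ := htop ▸ Submodule.mem_top
    rw [Submodule.mem_orthogonal_singleton_iff_inner_left] at this
    exact inner_self_eq_zero.mp this
  · have : {y : V | inner ℝ y e = c} = ∅ := by
      ext y; simp only [Set.mem_ofPred_eq, Set.mem_empty_iff_false, iff_false]
      exact fun h => hne ⟨y, h⟩
    simp [this]

end Slicing

/-! ### Vitali's convergence theorem -/

/-- Vitali convergence for nonnegative functions bounded in `L^{1+δ}` on a finite measure space. -/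
theorem tendsto_lintegral_of_lintegral_rpow_le {X ι : Type*} [MeasurableSpace X] {ν : Measure X}
    [IsFiniteMeasure ν] {l : Filter ι} [l.IsCountablyGenerated] {F : ι → X → ℝ≥0∞} {F₀ : X → ℝ≥0∞}
    (hF : ∀ᶠ i in l, Measurable (F i)) (hlim : ∀ᵐ x ∂ν, Filter.Tendsto (fun i => F i x) l (nhds (F₀ x)))
    {δ : ℝ} (hδ : 0 < δ) {C : ℝ≥0∞} (hC : C ≠ ⊤)
    (hbd : ∀ᶠ i in l, ∫⁻ x, F i x ^ (1 + δ) ∂ν ≤ C) (hbd₀ : ∫⁻ x, F₀ x ^ (1 + δ) ∂ν ≤ C)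
    (hF₀ : Measurable F₀) :
    Filter.Tendsto (fun i => ∫⁻ x, F i x ∂ν) l (nhds (∫⁻ x, F₀ x ∂ν)) := by
  -- Uniform integrability in quantitative form: f ≤ min f M + M^{-δ} f^{1+δ} pointwise. The
  -- truncated integrals converge by domination, and the error tends to 0 as M grows, uniformly in
  -- the index.
  have trunc : ∀ (M : ℝ), 0 < M → ∀ f : X → ℝ≥0∞, Measurable f → ∫⁻ x, f x ^ (1 + δ) ∂ν ≤ C →
      ∫⁻ x, f x ∂ν ≤ ∫⁻ x, min (f x) (ENNReal.ofReal M) ∂ν + ENNReal.ofReal M ^ (-δ) * C := by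
    intro M hM f hf hfC
    calc ∫⁻ x, f x ∂ν ≤ ∫⁻ x, (min (f x) (ENNReal.ofReal M) +
          ENNReal.ofReal M ^ (-δ) * f x ^ (1 + δ)) ∂ν := by
          refine lintegral_mono fun x => ?_
          rcases le_total (f x) (ENNReal.ofReal M) with h | h
          · rw [min_eq_left h]; exact le_self_add
          · refine le_add_left ?_
            have hM0 : ENNReal.ofReal M ≠ 0 := by simpa using hM
            have hf0 : f x ≠ 0 := (lt_of_lt_of_le (pos_iff_ne_zero.mpr hM0) h).ne'
            have h1 : ENNReal.ofReal M ^ (-δ) * ENNReal.ofReal M ^ δ = 1 := by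
              rw [← ENNReal.rpow_add _ _ hM0 ENNReal.ofReal_ne_top]; simp
            calc f x = ENNReal.ofReal M ^ (-δ) * ENNReal.ofReal M ^ δ * f x := by rw [h1, one_mul]
              _ ≤ ENNReal.ofReal M ^ (-δ) * f x ^ δ * f x := by
                gcongr
              _ = _ := by
                rw [mul_assoc]
                congr 1
                rw [ENNReal.rpow_add_of_nonneg _ _ zero_le_one hδ.le, ENNReal.rpow_one, mul_comm]
      _ = ∫⁻ x, min (f x) (ENNReal.ofReal M) ∂ν +
          ENNReal.ofReal M ^ (-δ) * ∫⁻ x, f x ^ (1 + δ) ∂ν := by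
          rw [lintegral_add_left (by fun_prop), lintegral_const_mul _ (by fun_prop)]
      _ ≤ _ := by gcongr
  have hconv : ∀ M : ℝ, Filter.Tendsto (fun i => ∫⁻ x, min (F i x) (ENNReal.ofReal M) ∂ν) l
      (nhds (∫⁻ x, min (F₀ x) (ENNReal.ofReal M) ∂ν)) := by
    intro M
    refine tendsto_lintegral_filter_of_dominated_convergence (fun _ => ENNReal.ofReal M) ?_ ?_ ?_ ?_
    · filter_upwards [hF] with i hi
      fun_prop
    · exact Filter.Eventually.of_forall fun i => Filter.Eventually.of_forall fun x => min_le_right _ _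
    · simp [ENNReal.mul_ne_top, measure_ne_top]
    · filter_upwards [hlim] with x hx
      exact hx.min tendsto_const_nhds
  have hfin : ∫⁻ x, F₀ x ∂ν ≠ ⊤ := by
    refine ne_top_of_le_ne_top ?_ (trunc 1 one_pos F₀ hF₀ hbd₀)
    refine ENNReal.add_ne_top.mpr ⟨?_, ?_⟩
    · refine ne_top_of_le_ne_top ?_ (lintegral_mono fun x => min_le_right _ _)
      simp [measure_ne_top]
    · simp [hC]
  have htail : Filter.Tendsto (fun M : ℝ => ENNReal.ofReal M ^ (-δ) * C) Filter.atTop (nhds 0) := by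
    have h1 : Filter.Tendsto (fun M : ℝ => ENNReal.ofReal (M ^ (-δ)) * C) Filter.atTop (nhds 0) := by
      have := (ENNReal.tendsto_ofReal (tendsto_rpow_neg_atTop hδ))
      have := ENNReal.Tendsto.mul_const this (Or.inr hC)
      simpa using this
    refine h1.congr' ?_
    filter_upwards [Filter.eventually_gt_atTop 0] with M hM
    rw [ENNReal.ofReal_rpow_of_pos hM]
  rw [ENNReal.tendsto_nhds hfin]
  intro ε hε
  have hε2 : 0 < ε / 2 := ENNReal.half_pos hε.ne'
  obtain ⟨M, hM, hMpos⟩ := ((htail.eventually (gt_mem_nhds hε2)).and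
    (Filter.eventually_gt_atTop 0)).exists
  have hfinM : ∫⁻ x, min (F₀ x) (ENNReal.ofReal M) ∂ν ≠ ⊤ :=
    ne_top_of_le_ne_top hfin (lintegral_mono fun x => min_le_left _ _)
  have hc := (ENNReal.tendsto_nhds hfinM).mp (hconv M) (ε / 2) hε2
  filter_upwards [hF, hbd, hc] with i hi hiC hic
  constructor
  · rw [tsub_le_iff_right]
    calc ∫⁻ x, F₀ x ∂ν ≤ _ := trunc M hMpos F₀ hF₀ hbd₀
      _ ≤ (∫⁻ x, min (F i x) (ENNReal.ofReal M) ∂ν + ε / 2) + ε / 2 := by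
        gcongr
        exact tsub_le_iff_right.mp hic.1
      _ ≤ _ := by
        rw [add_assoc, ENNReal.add_halves]
        gcongr
        exact min_le_left _ _
  · calc ∫⁻ x, F i x ∂ν ≤ _ := trunc M hMpos (F i) hi hiC
      _ ≤ (∫⁻ x, min (F₀ x) (ENNReal.ofReal M) ∂ν + ε / 2) + ε / 2 := by
        gcongr
        exact hic.2
      _ ≤ _ := by
        rw [add_assoc, ENNReal.add_halves]
        gcongr
        exact min_le_left _ _

/-! ### Antipodal symmetry and null sets of spherical measure -/

section Sphere

open scoped Pointwise

variable {n : ℕ}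

/-- Spherical Lebesgue measure is invariant under the antipodal map. -/
theorem measurePreserving_neg_toSphere :
    MeasurePreserving (fun u : S n => -u) (volume : Measure (E n)).toSphere
      (volume : Measure (E n)).toSphere := by
  have hm : Measurable (fun u : S n => -u) := continuous_neg.measurable
  refine ⟨hm, ?_⟩
  ext s hs
  rw [Measure.map_apply hm hs, Measure.toSphere_apply' _ (hm hs), Measure.toSphere_apply' _ hs]
  congr 1
  rw [← Measure.measure_neg]
  congr 1
  ext x
  simp only [Set.mem_neg, Set.mem_smul, Set.mem_image, Set.mem_preimage]
  constructor
  · rintro ⟨r, hr, _, ⟨u, hu, rfl⟩, hx⟩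
    exact ⟨r, hr, _, ⟨-u, hu, rfl⟩, by rw [← neg_neg x, ← hx]; simp⟩
  · rintro ⟨r, hr, _, ⟨u, hu, rfl⟩, hx⟩
    exact ⟨r, hr, _, ⟨-u, by simpa using hu, rfl⟩, by rw [← hx]; simp⟩

/-- Great subspheres are null sets. -/
theorem toSphere_inner_eq_zero (v : S n) :
    (volume : Measure (E n)).toSphere {u : S n | inner ℝ (u : E n) (v : E n) = 0} = 0 := by
  have hms : MeasurableSet {u : S n | inner ℝ (u : E n) (v : E n) = 0} :=
    (isClosed_eq (by fun_prop) continuous_const).measurableSet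
  rw [Measure.toSphere_apply' _ hms]
  have hv : (v : E n) ≠ 0 := ne_zero_of_mem_unit_sphere v
  have : Set.Ioo (0 : ℝ) 1 • ((↑) '' {u : S n | inner ℝ (u : E n) (v : E n) = 0}) ⊆
      {y : E n | inner ℝ y (v : E n) = 0} := by
    rintro _ ⟨r, -, _, ⟨u, hu, rfl⟩, rfl⟩
    simp only [Set.mem_ofPred_eq] at hu ⊢
    rw [inner_smul_left, hu, mul_zero]
  rw [measure_mono_null this (volume_hyperplane_eq_zero hv 0), mul_zero]

end Sphere

/-! ### The chord integral: chord reversal, slicing, monotonicity, homogeneity -/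

section ChordIntegral

open scoped Classical

variable {n : ℕ}

/-- The open polyhedron `{x : x ⬝ w < h w for all w ∈ W}`. -/
def openPoly (W : Finset (S n)) (h : S n → ℝ) : Set (E n) :=
  {x | ∀ w ∈ W, inner ℝ x (w : E n) < h w}

/-- The reciprocal of the radial function, with respect to `x`, of the polyhedron
`{x : x ⬝ w ≤ h w for all w ∈ W}`. -/
def invRadial (W : Finset (S n)) (h : S n → ℝ) (x : E n) (u : S n) : ℝ≥0∞ :=
  W.sup fun w => ENNReal.ofReal (inner ℝ (u : E n) (w : E n) / (h w - inner ℝ x (w : E n)))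

/-- The chord integral, up to a constant factor. -/
def chordIntegral (U : Finset (S n)) (q : ℝ) (h : S n → ℝ) : ℝ≥0∞ :=
  ∫⁻ u, (∫⁻ x in openPoly U h, invRadial U h x u ^ (1 - q)) ∂(volume : Measure (E n)).toSphere

/-- The directions pointing into the half-space with outer normal `v`. -/
def inwardDirections (v : S n) : Set (S n) := {u | inner ℝ (u : E n) (v : E n) < 0}

/-- The function whose integral over the facet with normal `v` is the chord measure of `v`. -/
def inwardIntegral (W : Finset (S n)) (v : S n) (q : ℝ) (h : S n → ℝ) (x : E n) : ℝ≥0∞ :=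
  ∫⁻ u in inwardDirections v, invRadial W h x u ^ (1 - q) ∂(volume : Measure (E n)).toSphere

/-- The integral of `inwardIntegral` over the slice at height `t` orthogonal to `v`. -/
def sliceIntegral (W : Finset (S n)) (v : S n) (q : ℝ) (h : S n → ℝ) (t : ℝ) : ℝ≥0∞ :=
  ∫⁻ y : (Submodule.span ℝ {(v : E n)})ᗮ,
    (openPoly W h).indicator (inwardIntegral W v q h) (t • (v : E n) + y)

theorem mem_openPoly {W : Finset (S n)} {h : S n → ℝ} {x : E n} :
    x ∈ openPoly W h ↔ ∀ w ∈ W, inner ℝ x (w : E n) < h w := Iff.rfl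

theorem mem_inwardDirections {u v : S n} :
    u ∈ inwardDirections v ↔ inner ℝ (u : E n) (v : E n) < 0 := Iff.rfl

theorem isOpen_openPoly (W : Finset (S n)) (h : S n → ℝ) : IsOpen (openPoly W h) := by
  have : openPoly W h = ⋂ w ∈ W, {x : E n | inner ℝ x (w : E n) < h w} := by
    ext x; simp [mem_openPoly]
  rw [this]
  exact isOpen_biInter_finset fun w _ => isOpen_lt (by fun_prop) continuous_const

theorem measurableSet_openPoly (W : Finset (S n)) (h : S n → ℝ) : MeasurableSet (openPoly W h) :=
  (isOpen_openPoly W h).measurableSet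

theorem measurableSet_inwardDirections (v : S n) : MeasurableSet (inwardDirections v) :=
  (isOpen_lt (by fun_prop) continuous_const).measurableSet

theorem openPoly_congr {W : Finset (S n)} {h h' : S n → ℝ} (hh : ∀ w ∈ W, h w = h' w) :
    openPoly W h = openPoly W h' := by
  ext x
  exact forall₂_congr fun w hw => by rw [hh w hw]

theorem invRadial_congr {W : Finset (S n)} {h h' : S n → ℝ} (hh : ∀ w ∈ W, h w = h' w)
    (x : E n) (u : S n) : invRadial W h x u = invRadial W h' x u :=
  Finset.sup_congr rfl fun w hw => by rw [hh w hw]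

theorem chordIntegral_congr {U : Finset (S n)} {h h' : S n → ℝ} (hh : ∀ w ∈ U, h w = h' w)
    (q : ℝ) : chordIntegral U q h = chordIntegral U q h' := by
  simp_rw [chordIntegral, openPoly_congr hh, invRadial_congr hh]

theorem sliceIntegral_congr {W : Finset (S n)} {h h' : S n → ℝ} (hh : ∀ w ∈ W, h w = h' w)
    (v : S n) (q : ℝ) (t : ℝ) : sliceIntegral W v q h t = sliceIntegral W v q h' t := by
  unfold sliceIntegral inwardIntegral
  simp_rw [openPoly_congr hh, invRadial_congr hh]

theorem measurable_invRadial (W : Finset (S n)) (h : S n → ℝ) {X : Type*} [MeasurableSpace X]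
    {f : X → E n} {g : X → S n} (hf : Measurable f) (hg : Measurable g) :
    Measurable fun z => invRadial W h (f z) (g z) := by
  unfold invRadial
  induction W using Finset.induction_on with
  | empty => simp
  | insert a s _ ih =>
    simp only [Finset.sup_insert]
    refine Measurable.sup ?_ ih
    fun_prop

theorem measurable_inwardIntegral (W : Finset (S n)) (v : S n) (q : ℝ) (h : S n → ℝ) :
    Measurable (inwardIntegral W v q h) :=
  Measurable.lintegral_prod_right' (f := fun z : E n × S n => invRadial W h z.1 z.2 ^ (1 - q))
    ((measurable_invRadial W h measurable_fst measurable_snd).pow_const _)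

theorem invRadial_lt_top (W : Finset (S n)) (h : S n → ℝ) (x : E n) (u : S n) :
    invRadial W h x u < ⊤ := by
  rw [invRadial, Finset.sup_lt_iff ENNReal.zero_lt_top]
  exact fun w _ => ENNReal.ofReal_lt_top

/-- Ties the algebraic formula to the set: the strict sublevel sets of 1/ρ in x are intersections of
the polyhedron with its translates along u. Chord reversal and independence of the chosen support
numbers both follow from this. -/
theorem invRadial_lt_iff {W : Finset (S n)} {h : S n → ℝ} {x : E n} (hx : x ∈ openPoly W h)
    (u : S n) {c : ℝ} (hc : 0 < c) :
    invRadial W h x u < ENNReal.ofReal c ↔ x + c⁻¹ • (u : E n) ∈ openPoly W h := by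
  rw [invRadial, Finset.sup_lt_iff (by simpa using hc), mem_openPoly]
  refine forall₂_congr fun w hw => ?_
  have hpos : 0 < h w - inner ℝ x (w : E n) := sub_pos.mpr (hx w hw)
  rw [ENNReal.ofReal_lt_ofReal_iff hc, div_lt_iff₀ hpos, inner_add_left, inner_smul_left]
  simp only [conj_trivial]
  rw [← lt_sub_iff_add_lt', inv_mul_lt_iff₀ hc]

/-- The sublevel sets in `invRadial_lt_iff` involve only the polyhedron, so redundant constraints do
not matter. This permits replacing support numbers by tight ones without changing the chord
integral. -/
theorem invRadial_eq_of_openPoly_eq {W : Finset (S n)} {h h' : S n → ℝ}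
    (hh : openPoly W h = openPoly W h') {x : E n} (hx : x ∈ openPoly W h) (u : S n) :
    invRadial W h x u = invRadial W h' x u := by
  refine eq_of_forall_gt_iff ?_
  intro c
  rcases eq_or_ne c ⊤ with rfl | hc
  · simp [invRadial_lt_top]
  rcases eq_or_ne c 0 with rfl | hc0
  · simp
  rw [← ENNReal.ofReal_toReal hc, invRadial_lt_iff hx u (ENNReal.toReal_pos hc0 hc),
    invRadial_lt_iff (hh ▸ hx) u (ENNReal.toReal_pos hc0 hc), hh]

theorem chordIntegral_eq_of_openPoly_eq {U : Finset (S n)} {h h' : S n → ℝ}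
    (hh : openPoly U h = openPoly U h') (q : ℝ) : chordIntegral U q h = chordIntegral U q h' := by
  unfold chordIntegral
  refine lintegral_congr fun u => ?_
  rw [← hh]
  refine setLIntegral_congr_fun (measurableSet_openPoly U h) fun x hx => ?_
  rw [invRadial_eq_of_openPoly_eq hh hx]

/-- A ray that does not move towards the hyperplane of v is never stopped by it: the quotient for v
is nonpositive and drops out of the maximum. -/
theorem invRadial_erase {U : Finset (S n)} {h : S n → ℝ} {v u : S n} {x : E n}
    (hx : inner ℝ x (v : E n) ≤ h v) (hu : inner ℝ (u : E n) (v : E n) ≤ 0) :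
    invRadial U h x u = invRadial (U.erase v) h x u := by
  refine le_antisymm (Finset.sup_le fun w hw => ?_) (Finset.sup_mono (Finset.erase_subset _ _))
  rcases eq_or_ne w v with rfl | hwv
  · rw [ENNReal.ofReal_of_nonpos (div_nonpos_of_nonpos_of_nonneg hu (sub_nonneg.mpr hx))]
    exact zero_le
  · exact Finset.le_sup (f := fun w : S n =>
      ENNReal.ofReal (inner ℝ (u : E n) (w : E n) / (h w - inner ℝ x (w : E n))))
      (Finset.mem_erase.mpr ⟨hwv, hw⟩)

variable {U : Finset (S n)} {ε : ℝ}

/-- If every direction makes an angle bounded away from `π/2` with some element of `U`, the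
polyhedra with normals `U` are bounded. -/
theorem norm_le_of_mem_openPoly (hU : ∀ u : S n, ∃ w ∈ U, ε ≤ inner ℝ (u : E n) (w : E n))
    {h : S n → ℝ} {x : E n} (hx : x ∈ openPoly U h) : ε * ‖x‖ ≤ ∑ w ∈ U, |h w| := by
  have hs : 0 ≤ ∑ w ∈ U, |h w| := Finset.sum_nonneg fun _ _ => abs_nonneg _
  rcases eq_or_ne x 0 with rfl | hx0
  · simpa using hs
  have hpos : 0 < ‖x‖ := norm_pos_iff.mpr hx0
  obtain ⟨w, hw, hle⟩ := hU ⟨‖x‖⁻¹ • x, by simp [norm_smul, inv_mul_cancel₀ hpos.ne']⟩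
  simp only [inner_smul_left, conj_trivial] at hle
  have h1 : ε * ‖x‖ ≤ inner ℝ x (w : E n) := by
    have := mul_le_mul_of_nonneg_left hle hpos.le
    rwa [mul_inv_cancel_left₀ hpos.ne', mul_comm] at this
  calc ε * ‖x‖ ≤ h w := h1.trans (hx w hw).le
    _ ≤ |h w| := le_abs_self _
    _ ≤ _ := Finset.single_le_sum (f := fun w => |h w|) (fun _ _ => abs_nonneg _) hw

theorem openPoly_subset_ball (hε : 0 < ε)
    (hU : ∀ u : S n, ∃ w ∈ U, ε ≤ inner ℝ (u : E n) (w : E n)) (h : S n → ℝ) :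
    openPoly U h ⊆ ball 0 ((∑ w ∈ U, |h w|) / ε + 1) := by
  intro x hx
  rw [mem_ball_zero_iff]
  have := (le_div_iff₀' hε).mpr (norm_le_of_mem_openPoly hU hx)
  linarith

theorem volume_openPoly_lt_top (hε : 0 < ε)
    (hU : ∀ u : S n, ∃ w ∈ U, ε ≤ inner ℝ (u : E n) (w : E n)) (h : S n → ℝ) :
    volume (openPoly U h) < ⊤ :=
  lt_of_le_of_lt (measure_mono (openPoly_subset_ball hε hU h)) measure_ball_lt_top

/-- Reversing the chords of a polytope in a given direction preserves integrals of functions of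
the radial function. -/
theorem setLIntegral_invRadial_neg {h : S n → ℝ} (hfin : volume (openPoly U h) < ⊤) (u : S n)
    (e : ℝ) :
    ∫⁻ x in openPoly U h, invRadial U h x (-u) ^ e = ∫⁻ x in openPoly U h, invRadial U h x u ^ e := by
  have hm : ∀ u, Measurable fun x => invRadial U h x u := fun u =>
    measurable_invRadial U h measurable_id measurable_const
  set ν := volume.restrict (openPoly U h) with hν
  have : IsFiniteMeasure ν := ⟨by simpa [hν] using hfin⟩
  have key : ν.map (fun x => invRadial U h x (-u)) = ν.map (fun x => invRadial U h x u) := by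
    refine Measure.ext_of_Ici _ _ fun a => ?_
    rw [Measure.map_apply (hm _) measurableSet_Ici, Measure.map_apply (hm _) measurableSet_Ici]
    rcases eq_or_ne a ⊤ with rfl | ha
    · have h1 : ∀ u, (fun x => invRadial U h x u) ⁻¹' Set.Ici ⊤ = ∅ := by
        intro u; ext x
        simp only [Set.mem_preimage, Set.mem_Ici, Set.mem_empty_iff_false, iff_false, not_le]
        exact invRadial_lt_top _ _ _ _
      rw [h1, h1]
    rcases eq_or_ne a 0 with rfl | ha0
    · simp
    have hc : 0 < a.toReal := ENNReal.toReal_pos ha0 ha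
    have hcompl : ∀ u, ν ((fun x => invRadial U h x u) ⁻¹' Set.Ici a) =
        ν Set.univ - volume {x | x ∈ openPoly U h ∧ x + a.toReal⁻¹ • (u : E n) ∈ openPoly U h} := by
      intro u
      have h1 : (fun x => invRadial U h x u) ⁻¹' Set.Ici a =
          ((fun x => invRadial U h x u) ⁻¹' Set.Iio a)ᶜ := by
        ext x; simp
      rw [h1, measure_compl (hm u measurableSet_Iio) (measure_ne_top _ _)]
      congr 1
      rw [hν, Measure.restrict_apply (hm u measurableSet_Iio)]
      congr 1
      ext x
      simp only [Set.mem_inter_iff, Set.mem_preimage, Set.mem_Iio, Set.mem_ofPred_eq]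
      rw [and_comm]
      refine and_congr_right fun hx => ?_
      rw [← invRadial_lt_iff hx u hc, ENNReal.ofReal_toReal ha]
    rw [hcompl, hcompl]
    congr 1
    -- Translation by s u, with s the reciprocal of the level, carries the points x of P with x + s
    -- u in P to those with x - s u in P. Hence ρ(·, u) and ρ(·, -u) have the same distribution on
    -- P.
    rw [← measure_preimage_add_right volume (a.toReal⁻¹ • (u : E n))]
    congr 1
    ext x
    simp only [Set.mem_preimage, Set.mem_ofPred_eq, Metric.sphere, coe_neg_sphere, smul_neg]
    rw [and_comm, add_neg_cancel_right]
  have h1 := congrArg (fun m => ∫⁻ z, z ^ e ∂m) key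
  rwa [lintegral_map (by fun_prop) (hm _), lintegral_map (by fun_prop) (hm _)] at h1

/-- The antipodal map exchanges the two open hemispheres bounded by the great subsphere orthogonal
to v, which is null, and chord reversal makes the inner integral even in u. -/
theorem chordIntegral_eq_two_mul {h : S n → ℝ} (hfin : volume (openPoly U h) < ⊤) (q : ℝ)
    (v : S n) :
    chordIntegral U q h = 2 * ∫⁻ x in openPoly U h, inwardIntegral U v q h x := by
  set σ := (volume : Measure (E n)).toSphere
  set A : S n → ℝ≥0∞ := fun u => ∫⁻ x in openPoly U h, invRadial U h x u ^ (1 - q) with hA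
  have hjoint : Measurable fun z : S n × E n => invRadial U h z.2 z.1 ^ (1 - q) :=
    (measurable_invRadial U h measurable_snd measurable_fst).pow_const _
  have hAm : Measurable A := Measurable.lintegral_prod_right'
    (f := fun z : S n × E n => invRadial U h z.2 z.1 ^ (1 - q)) hjoint
  have hneg : ∀ u, A (-u) = A u := fun u => setLIntegral_invRadial_neg hfin u _
  set N := inwardDirections v
  have hN : MeasurableSet N := measurableSet_inwardDirections v
  have h1 : ∫⁻ u in Nᶜ, A u ∂σ = ∫⁻ u in N, A u ∂σ := by
    have h2 : ∫⁻ u in N, A u ∂σ = ∫⁻ u in (fun u => -u) ⁻¹' N, A u ∂σ := by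
      rw [← measurePreserving_neg_toSphere.setLIntegral_comp_preimage hN hAm]
      simp_rw [hneg]
      rfl
    rw [h2]
    refine setLIntegral_congr ?_
    have hz := toSphere_inner_eq_zero v
    have hz' : ∀ᵐ u : S n ∂σ, inner ℝ (u : E n) (v : E n) ≠ 0 := by
      rw [ae_iff]; simpa using hz
    filter_upwards [hz'] with u hu
    apply propext
    change (¬ (inner ℝ (u : E n) (v : E n) < 0)) ↔ (inner ℝ ((-u : S n) : E n) (v : E n) < 0)
    have hcoe : ((-u : S n) : E n) = -(u : E n) := rfl
    rw [hcoe, inner_neg_left, not_lt, neg_lt_zero]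
    exact ⟨fun h => lt_of_le_of_ne h (Ne.symm hu), le_of_lt⟩
  calc chordIntegral U q h = ∫⁻ u, A u ∂σ := rfl
    _ = ∫⁻ u in N, A u ∂σ + ∫⁻ u in Nᶜ, A u ∂σ := (lintegral_add_compl _ hN).symm
    _ = 2 * ∫⁻ u in N, A u ∂σ := by rw [h1, two_mul]
    _ = _ := by
      congr 1
      exact lintegral_lintegral_swap hjoint.aemeasurable

/-- The chord integral as an integral over the slices orthogonal to `v`. -/
theorem chordIntegral_eq_lintegral_slices {h : S n → ℝ} (hfin : volume (openPoly U h) < ⊤) (q : ℝ)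
    {v : S n} (hv : v ∈ U) :
    chordIntegral U q h = 2 * ∫⁻ t in Set.Iio (h v), sliceIntegral (U.erase v) v q h t := by
  rw [chordIntegral_eq_two_mul hfin q v]
  congr 1
  have h1 : ∀ x ∈ openPoly U h,
      inwardIntegral U v q h x = inwardIntegral (U.erase v) v q h x := by
    intro x hx
    refine setLIntegral_congr_fun (measurableSet_inwardDirections v) fun u hu => ?_
    rw [invRadial_erase (hx v hv).le (le_of_lt hu)]
  rw [setLIntegral_congr_fun (measurableSet_openPoly U h) h1,
    ← lintegral_indicator (measurableSet_openPoly U h),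
    lintegral_eq_lintegral_slices (v := (v : E n)) (by simp)
      ((measurable_inwardIntegral _ _ _ _).indicator (measurableSet_openPoly U h)),
    ← lintegral_indicator measurableSet_Iio]
  refine lintegral_congr fun t => ?_
  have hiff : ∀ y : (Submodule.span ℝ {(v : E n)})ᗮ, t • (v : E n) + (y : E n) ∈ openPoly U h ↔
      t < h v ∧ t • (v : E n) + (y : E n) ∈ openPoly (U.erase v) h := by
    intro y
    have hyv : inner ℝ (y : E n) (v : E n) = 0 :=
      (Submodule.mem_orthogonal_singleton_iff_inner_left).mp y.2
    have ht : inner ℝ (t • (v : E n) + (y : E n)) (v : E n) = t := by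
      rw [inner_add_left, hyv, inner_smul_left, real_inner_self_eq_norm_sq]
      simp
    constructor
    · intro hx
      exact ⟨ht ▸ hx v hv, fun w hw => hx w (Finset.mem_of_mem_erase hw)⟩
    · rintro ⟨h1, h2⟩ w hw
      rcases eq_or_ne w v with rfl | hwv
      · rwa [ht]
      · exact h2 w (Finset.mem_erase.mpr ⟨hwv, hw⟩)
  by_cases ht : t < h v
  · rw [Set.indicator_of_mem (by exact ht)]
    refine lintegral_congr fun y => ?_
    by_cases hy : t • (v : E n) + (y : E n) ∈ openPoly (U.erase v) h
    · rw [Set.indicator_of_mem hy, Set.indicator_of_mem ((hiff y).mpr ⟨ht, hy⟩)]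
    · rw [Set.indicator_of_notMem hy, Set.indicator_of_notMem fun h' => hy ((hiff y).mp h').2]
  · rw [Set.indicator_of_notMem (by exact ht)]
    rw [lintegral_eq_zero_of_ae_eq_zero]
    exact Filter.Eventually.of_forall fun y =>
      Set.indicator_of_notMem (fun h' => ht ((hiff y).mp h').1) _

/-- The slice integrals use only the constraints other than v, so moving the support number of v
changes just the range of heights. Differentiability, finiteness and monotonicity in one variable
are read off from this. -/
theorem chordIntegral_update {h : S n → ℝ} (hε : 0 < ε)
    (hU : ∀ u : S n, ∃ w ∈ U, ε ≤ inner ℝ (u : E n) (w : E n)) (q : ℝ)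
    {v : S n} (hv : v ∈ U) (τ : ℝ) :
    chordIntegral U q (Function.update h v τ) =
      2 * ∫⁻ t in Set.Iio τ, sliceIntegral (U.erase v) v q h t := by
  rw [chordIntegral_eq_lintegral_slices (volume_openPoly_lt_top hε hU _) q hv,
    Function.update_self]
  congr 1
  refine lintegral_congr fun t => sliceIntegral_congr (fun w hw => ?_) _ _ _
  rw [Function.update_of_ne (Finset.ne_of_mem_erase hw)]

/-- For q < 1 the integrand ρ^{q-1} decreases as the polytope grows, so monotonicity is not
pointwise. Raising one support number at a time enlarges only the range of integration of a fixed
nonnegative function. -/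
theorem chordIntegral_mono (hε : 0 < ε)
    (hU : ∀ u : S n, ∃ w ∈ U, ε ≤ inner ℝ (u : E n) (w : E n)) (q : ℝ) {h h' : S n → ℝ}
    (hh : ∀ w ∈ U, h w ≤ h' w) : chordIntegral U q h ≤ chordIntegral U q h' := by
  have key : ∀ T : Finset (S n), T ⊆ U →
      chordIntegral U q h ≤ chordIntegral U q (T.piecewise h' h) := by
    intro T
    induction T using Finset.induction_on with
    | empty => intro _; simp
    | insert a s has ih =>
      intro hT
      have haU : a ∈ U := hT (Finset.mem_insert_self _ _)
      refine (ih fun x hx => hT (Finset.mem_insert_of_mem hx)).trans ?_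
      rw [Finset.piecewise_insert]
      conv_lhs => rw [← Function.update_eq_self a (s.piecewise h' h)]
      rw [chordIntegral_update hε hU q haU, chordIntegral_update hε hU q haU]
      gcongr
      rw [Finset.piecewise_eq_of_notMem _ _ _ has]
      exact hh a haU
  refine (key U subset_rfl).trans (le_of_eq (chordIntegral_congr (fun w hw => ?_) q))
  exact Finset.piecewise_eq_of_mem _ _ _ hw

theorem chordIntegral_add_inner (U : Finset (S n)) (q : ℝ) (h : S n → ℝ) (ξ : E n) :
    chordIntegral U q (fun w => h w + inner ℝ ξ (w : E n)) = chordIntegral U q h := by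
  unfold chordIntegral
  refine lintegral_congr fun u => ?_
  rw [← lintegral_indicator (measurableSet_openPoly _ _),
    ← lintegral_indicator (measurableSet_openPoly _ _), ← lintegral_add_right_eq_self _ ξ]
  refine lintegral_congr fun x => ?_
  have h1 : x + ξ ∈ openPoly U (fun w => h w + inner ℝ ξ (w : E n)) ↔ x ∈ openPoly U h := by
    simp only [mem_openPoly, inner_add_left, add_lt_add_iff_right]
  have h2 : invRadial U (fun w => h w + inner ℝ ξ (w : E n)) (x + ξ) u = invRadial U h x u := by
    simp only [invRadial, inner_add_left, add_sub_add_right_eq_sub]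
  by_cases hx : x ∈ openPoly U h
  · rw [Set.indicator_of_mem hx, Set.indicator_of_mem (h1.mpr hx), h2]
  · rw [Set.indicator_of_notMem hx, Set.indicator_of_notMem (mt h1.mp hx)]

theorem chordIntegral_const_mul (U : Finset (S n)) (q : ℝ) (h : S n → ℝ) {c : ℝ} (hc : 0 < c) :
    chordIntegral U q (fun w => c * h w) =
      ENNReal.ofReal (c ^ ((n : ℝ) + q - 1)) * chordIntegral U q h := by
  unfold chordIntegral
  have hmeas : Measurable fun u : S n => ∫⁻ x in openPoly U h, invRadial U h x u ^ (1 - q) :=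
    Measurable.lintegral_prod_right' (f := fun z : S n × E n => invRadial U h z.2 z.1 ^ (1 - q))
      ((measurable_invRadial U h measurable_snd measurable_fst).pow_const _)
  rw [← lintegral_const_mul _ hmeas]
  refine lintegral_congr fun u => ?_
  have hm : Measurable fun x => invRadial U h x u :=
    measurable_invRadial U h measurable_id measurable_const
  have hm' : Measurable fun x => invRadial U (fun w => c * h w) x u :=
    measurable_invRadial U _ measurable_id measurable_const
  rw [← lintegral_indicator (measurableSet_openPoly _ _),
    ← lintegral_indicator (measurableSet_openPoly _ _)]
  set F := (openPoly U fun w => c * h w).indicator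
    fun x => invRadial U (fun w => c * h w) x u ^ (1 - q) with hF
  have hFm : Measurable F := (hm'.pow_const _).indicator (measurableSet_openPoly _ _)
  have h1 : ∫⁻ x, F (c • x) = ENNReal.ofReal ((c ^ n)⁻¹) * ∫⁻ x, F x := by
    have := lintegral_map (μ := volume) hFm (measurable_const_smul c : Measurable fun x : E n => c • x)
    rw [← this, Measure.map_addHaar_smul _ hc.ne', lintegral_smul_measure, smul_eq_mul]
    congr 2
    rw [finrank_euclideanSpace_fin, abs_of_pos (by positivity)]
  have h2 : ∀ x, F (c • x) = ENNReal.ofReal (c ^ (q - 1)) *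
      (openPoly U h).indicator (fun x => invRadial U h x u ^ (1 - q)) x := by
    intro x
    have hiff : c • x ∈ openPoly U (fun w => c * h w) ↔ x ∈ openPoly U h := by
      simp only [mem_openPoly, inner_smul_left, conj_trivial]
      exact forall₂_congr fun w _ => mul_lt_mul_iff_right₀ hc
    by_cases hx : x ∈ openPoly U h
    · rw [hF, Set.indicator_of_mem (hiff.mpr hx), Set.indicator_of_mem hx]
      have : invRadial U (fun w => c * h w) (c • x) u =
          ENNReal.ofReal c⁻¹ * invRadial U h x u := by
        rw [invRadial, invRadial, Finset.apply_sup_eq_sup_comp_of_linearOrder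
          (fun z : ℝ≥0∞ => ENNReal.ofReal c⁻¹ * z) (fun _ _ h => mul_le_mul_right h _) (by simp)]
        refine Finset.sup_congr rfl fun w _ => ?_
        simp only [Function.comp_apply]
        rw [← ENNReal.ofReal_mul (by positivity), inner_smul_left, conj_trivial, ← mul_sub]
        congr 1
        rw [inv_eq_one_div, div_mul_div_comm, one_mul]
      rw [this, ENNReal.mul_rpow_of_ne_top ENNReal.ofReal_ne_top (invRadial_lt_top _ _ _ _).ne,
        ENNReal.ofReal_rpow_of_pos (by positivity), Real.inv_rpow hc.le, ← Real.rpow_neg hc.le,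
        neg_sub]
    · rw [hF, Set.indicator_of_notMem (mt hiff.mp hx), Set.indicator_of_notMem hx, mul_zero]
  simp_rw [h2] at h1
  rw [lintegral_const_mul _ ((hm.pow_const _).indicator (measurableSet_openPoly _ _))] at h1
  have h3 : ENNReal.ofReal (c ^ n) * ENNReal.ofReal ((c ^ n)⁻¹) = 1 := by
    rw [← ENNReal.ofReal_mul (by positivity), mul_inv_cancel₀ (by positivity), ENNReal.ofReal_one]
  calc ∫⁻ x, F x = ENNReal.ofReal (c ^ n) * (ENNReal.ofReal ((c ^ n)⁻¹) * ∫⁻ x, F x) := by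
        rw [← mul_assoc, h3, one_mul]
    _ = _ := by
        rw [← h1, ← mul_assoc, ← ENNReal.ofReal_mul (by positivity), ← Real.rpow_natCast,
          ← Real.rpow_add hc]
        congr 3
        ring

end ChordIntegral

/-! ### Finiteness, continuity and partial derivatives of the chord integral -/

section Derivative

open scoped Classical

variable {n : ℕ} {U : Finset (S n)} {ε : ℝ}

/-- If q < 1, the maximum is attained by some w, and u ⬝ w ≤ 1 bounds its power by the distance term
with a = 1 - q. If q ≥ 1, the exponent is nonpositive and 1/ρ is bounded below by ε / max H 1, so a
constant suffices and a = 1/2 is arbitrary. -/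
theorem exists_invRadial_rpow_le {q : ℝ} (hq : 0 < q) :
    ∃ a : ℝ, 0 < a ∧ a < 1 ∧ ∀ (W : Finset (S n)) (h : S n → ℝ) (ε H : ℝ), 0 < ε →
      ∃ C : ℝ≥0∞, C ≠ ⊤ ∧ ∀ x ∈ openPoly W h, (∀ w ∈ W, h w - inner ℝ x (w : E n) ≤ H) →
        ∀ u : S n, (∃ w ∈ W, ε ≤ inner ℝ (u : E n) (w : E n)) →
        invRadial W h x u ^ (1 - q) ≤
          C + ∑ w ∈ W, ENNReal.ofReal (1 / (h w - inner ℝ x (w : E n))) ^ a := by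
  rcases lt_or_ge q 1 with hq1 | hq1
  · refine ⟨1 - q, by linarith, by linarith, fun W h ε H _ => ⟨0, ENNReal.zero_ne_top,
      fun x hx _ u hu => ?_⟩⟩
    obtain ⟨w₀, hw₀, -⟩ := hu
    obtain ⟨w, hw, heq⟩ := Finset.exists_mem_eq_sup W ⟨w₀, hw₀⟩ fun w : S n =>
      ENNReal.ofReal (inner ℝ (u : E n) (w : E n) / (h w - inner ℝ x (w : E n)))
    rw [zero_add, invRadial, heq]
    refine le_trans ?_ (Finset.single_le_sum (f := fun w : S n =>
      ENNReal.ofReal (1 / (h w - inner ℝ x (w : E n))) ^ (1 - q)) (fun _ _ => zero_le) hw)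
    refine ENNReal.rpow_le_rpow (ENNReal.ofReal_le_ofReal ?_) (by linarith)
    have hpos : 0 < h w - inner ℝ x (w : E n) := sub_pos.mpr (hx w hw)
    gcongr
    calc inner ℝ (u : E n) (w : E n) ≤ ‖(u : E n)‖ * ‖(w : E n)‖ := real_inner_le_norm _ _
      _ = 1 := by simp
  · refine ⟨1 / 2, by norm_num, by norm_num, fun W h ε H hε => ⟨ENNReal.ofReal (ε / max H 1) ^ (1 - q),
      ?_, fun x hx hH u hu => ?_⟩⟩
    · have : 0 < ε / max H 1 := by positivity
      rw [ENNReal.ofReal_rpow_of_pos this]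
      exact ENNReal.ofReal_ne_top
    · obtain ⟨w, hw, hle⟩ := hu
      refine le_add_right ?_
      rw [← neg_sub q 1, ENNReal.rpow_neg, ENNReal.rpow_neg, ENNReal.inv_le_inv]
      refine ENNReal.rpow_le_rpow ?_ (by linarith)
      refine le_trans (ENNReal.ofReal_le_ofReal ?_) (Finset.le_sup (f := fun w : S n =>
        ENNReal.ofReal (inner ℝ (u : E n) (w : E n) / (h w - inner ℝ x (w : E n)))) hw)
      have hpos : 0 < h w - inner ℝ x (w : E n) := sub_pos.mpr (hx w hw)
      exact div_le_div₀ (hε.le.trans hle) hle hpos ((hH w hw).trans (le_max_left _ _))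

theorem abs_inner_sphere_le (x : E n) (w : S n) : |inner ℝ x (w : E n)| ≤ ‖x‖ := by
  simpa using abs_real_inner_le_norm x (w : E n)

theorem chordIntegral_lt_top (hε : 0 < ε)
    (hU : ∀ u : S n, ∃ w ∈ U, ε ≤ inner ℝ (u : E n) (w : E n)) {q : ℝ} (hq : 0 < q)
    (h : S n → ℝ) : chordIntegral U q h < ⊤ := by
  obtain ⟨a, ha, ha1, hbound⟩ := exists_invRadial_rpow_le (n := n) hq
  set R := (∑ w ∈ U, |h w|) / ε + 1 with hR
  have hsub := openPoly_subset_ball hε hU h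
  obtain ⟨C, hC, hCle⟩ := hbound U h ε ((∑ w ∈ U, |h w|) + R) hε
  choose D hD hDle using fun w : S n =>
    lintegral_ball_one_div_rpow_le (ne_zero_of_mem_unit_sphere w : (w : E n) ≠ 0) ha ha1 R
  have hinner : ∀ u : S n, ∫⁻ x in openPoly U h, invRadial U h x u ^ (1 - q) ≤
      C * volume (ball (0 : E n) R) + ∑ w ∈ U, D w := by
    intro u
    calc ∫⁻ x in openPoly U h, invRadial U h x u ^ (1 - q)
        ≤ ∫⁻ x in openPoly U h,
          (C + ∑ w ∈ U, ENNReal.ofReal (1 / (h w - inner ℝ x (w : E n))) ^ a) := by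
          refine setLIntegral_mono' (measurableSet_openPoly U h) fun x hx =>
            hCle x hx (fun w hw => ?_) u (hU u)
          have h1 := Finset.single_le_sum (f := fun w => |h w|) (fun _ _ => abs_nonneg _) hw
          have h2 := abs_inner_sphere_le x w
          have h3 := mem_ball_zero_iff.mp (hsub hx)
          have h4 := le_abs_self (h w)
          have h5 := neg_abs_le (inner ℝ x (w : E n))
          linarith
      _ ≤ ∫⁻ x in ball (0 : E n) R,
          (C + ∑ w ∈ U, ENNReal.ofReal (1 / (h w - inner ℝ x (w : E n))) ^ a) :=
          lintegral_mono_set hsub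
      _ = C * volume (ball (0 : E n) R) + ∑ w ∈ U, ∫⁻ x in ball (0 : E n) R,
          ENNReal.ofReal (1 / (h w - inner ℝ x (w : E n))) ^ a := by
          rw [lintegral_add_left measurable_const, lintegral_finsetSum _ (fun w _ => by fun_prop),
            setLIntegral_const]
      _ ≤ _ := by
          gcongr with w hw
          exact hDle w _
  refine lt_of_le_of_lt (lintegral_mono hinner) ?_
  rw [lintegral_const]
  refine ENNReal.mul_lt_top (ENNReal.add_lt_top.mpr ⟨ENNReal.mul_lt_top hC.lt_top
    measure_ball_lt_top, ENNReal.sum_lt_top.mpr fun w _ => (hD w).lt_top⟩) (measure_lt_top _ _)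

theorem invRadial_pos (hε : 0 < ε)
    (hU : ∀ u : S n, ∃ w ∈ U, ε ≤ inner ℝ (u : E n) (w : E n)) {h : S n → ℝ} {x : E n}
    (hx : x ∈ openPoly U h) (u : S n) : 0 < invRadial U h x u := by
  obtain ⟨w, hw, hle⟩ := hU u
  refine lt_of_lt_of_le ?_ (Finset.le_sup (f := fun w : S n =>
    ENNReal.ofReal (inner ℝ (u : E n) (w : E n) / (h w - inner ℝ x (w : E n)))) hw)
  rw [ENNReal.ofReal_pos]
  exact div_pos (hε.trans_le hle) (sub_pos.mpr (hx w hw))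

theorem chordIntegral_pos (hn : 1 ≤ n) (hε : 0 < ε)
    (hU : ∀ u : S n, ∃ w ∈ U, ε ≤ inner ℝ (u : E n) (w : E n)) {q : ℝ}
    {h : S n → ℝ} (hh : ∀ w ∈ U, 0 < h w) : 0 < chordIntegral U q h := by
  have hjoint : Measurable fun z : S n × E n => invRadial U h z.2 z.1 ^ (1 - q) :=
    (measurable_invRadial U h measurable_snd measurable_fst).pow_const _
  have hAm : Measurable fun u => ∫⁻ x in openPoly U h, invRadial U h x u ^ (1 - q) :=
    Measurable.lintegral_prod_right' hjoint
  have hpos : ∀ u : S n, 0 < ∫⁻ x in openPoly U h, invRadial U h x u ^ (1 - q) := by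
    intro u
    have hm : Measurable fun x => invRadial U h x u ^ (1 - q) :=
      (measurable_invRadial U h measurable_id measurable_const).pow_const _
    rw [setLIntegral_pos_iff hm]
    have hsub : openPoly U h ⊆ Function.support (fun x => invRadial U h x u ^ (1 - q)) ∩
        openPoly U h := by
      intro x hx
      refine ⟨(ENNReal.rpow_pos (invRadial_pos hε hU hx u) (invRadial_lt_top _ _ _ _).ne).ne', hx⟩
    refine lt_of_lt_of_le ?_ (measure_mono hsub)
    refine (isOpen_openPoly U h).measure_pos _ ⟨0, fun w hw => ?_⟩
    simpa using hh w hw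
  have : Nontrivial (E n) := by
    have : Nonempty (Fin n) := ⟨⟨0, hn⟩⟩
    infer_instance
  rw [chordIntegral, lintegral_pos_iff_support hAm]
  have hs : (Function.support fun u => ∫⁻ x in openPoly U h, invRadial U h x u ^ (1 - q)) =
      Set.univ := Set.eq_univ_of_forall fun u => (hpos u).ne'
  rw [hs]
  exact Measure.measure_univ_pos.mpr (Measure.toSphere_ne_zero _)

/-- The chord integral is continuous in the support numbers. -/
theorem continuousAt_chordIntegral (hε : 0 < ε)
    (hU : ∀ u : S n, ∃ w ∈ U, ε ≤ inner ℝ (u : E n) (w : E n)) {q : ℝ} (hq : 0 < q)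
    {h : S n → ℝ} (hh : ∀ w ∈ U, 0 < h w) : ContinuousAt (chordIntegral U q) h := by
  set G := chordIntegral U q h
  have hG : G ≠ ⊤ := (chordIntegral_lt_top hε hU hq h).ne
  -- Continuity comes from homogeneity: near h, every h' lies on U between c h and d h for constants
  -- c < 1 < d. Monotonicity squeezes its chord integral between c^{n+q-1} G and d^{n+q-1} G, and
  -- the constants may be taken close to 1.
  have hcont : Filter.Tendsto (fun c : ℝ => ENNReal.ofReal (c ^ ((n : ℝ) + q - 1)) * G)
      (nhds 1) (nhds G) := by
    have h1 : ContinuousAt (fun c : ℝ => c ^ ((n : ℝ) + q - 1)) 1 :=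
      Real.continuousAt_rpow_const 1 _ (Or.inl one_ne_zero)
    have h2 := ENNReal.Tendsto.mul_const (b := G) (ENNReal.tendsto_ofReal h1.tendsto) (Or.inr hG)
    simpa using h2
  have hnear : ∀ c d : ℝ, c < 1 → 1 < d → ∀ᶠ h' in nhds h, ∀ w ∈ U, c * h w < h' w ∧ h' w < d * h w := by
    intro c d hc hd
    rw [Filter.eventually_all_finset]
    intro w hw
    have hw' := hh w hw
    exact (continuous_apply w).continuousAt.eventually
      (Ioo_mem_nhds (show c * h w < h w by nlinarith) (by nlinarith))
  refine tendsto_order.mpr ⟨fun a haG => ?_, fun a haG => ?_⟩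
  · obtain ⟨c, hca, hc0, hc1⟩ := (((hcont.mono_left nhdsWithin_le_nhds).eventually (lt_mem_nhds haG)).and
      (Ioo_mem_nhdsLT (zero_lt_one (α := ℝ)))).exists
    filter_upwards [hnear c 2 hc1 (by norm_num)] with h' hh'
    refine lt_of_lt_of_le hca ?_
    rw [← chordIntegral_const_mul U q h hc0]
    exact chordIntegral_mono hε hU q fun w hw => (hh' w hw).1.le
  · obtain ⟨c, hca, hc1, -⟩ := (((hcont.mono_left nhdsWithin_le_nhds).eventually (gt_mem_nhds haG)).and
      (Ioo_mem_nhdsGT (one_lt_two (α := ℝ)))).exists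
    filter_upwards [hnear 0 c (by norm_num) hc1] with h' hh'
    refine lt_of_le_of_lt ?_ hca
    rw [← chordIntegral_const_mul U q h (zero_lt_one.trans hc1)]
    exact chordIntegral_mono hε hU q fun w hw => (hh' w hw).2.le

/-- For a unit vector `w ≠ ±v`, the functional `⟪·, w⟫` on the orthogonal complement of `v` is
represented by a nonzero vector. -/
theorem exists_inner_eq_of_ne {v w : S n} (hne : w ≠ v) (hneg : w ≠ -v) :
    ∃ e : (Submodule.span ℝ {(v : E n)})ᗮ, e ≠ 0 ∧
      ∀ y : (Submodule.span ℝ {(v : E n)})ᗮ, inner ℝ (y : E n) (w : E n) = inner ℝ y e := by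
  have hvv : inner ℝ (v : E n) (v : E n) = 1 := by
    rw [real_inner_self_eq_norm_sq]; simp
  set c := inner ℝ (w : E n) (v : E n) with hc
  refine ⟨⟨(w : E n) - c • (v : E n), ?_⟩, ?_, fun y => ?_⟩
  · rw [Submodule.mem_orthogonal_singleton_iff_inner_left, inner_sub_left, inner_smul_left, hvv]
    simp [hc]
  · intro h0
    have hw : (w : E n) = c • (v : E n) := by
      have := congrArg Subtype.val h0
      simpa [sub_eq_zero] using this
    have hn : |c| = 1 := by
      have := congrArg norm hw
      simpa [norm_smul] using this.symm
    rcases (abs_eq zero_le_one).mp hn with h1 | h1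
    · exact hne (Subtype.ext (by rw [hw, h1, one_smul]))
    · exact hneg (Subtype.ext (by rw [hw, h1, neg_one_smul]; rfl))
  · have hyv : inner ℝ (y : E n) (v : E n) = 0 :=
      (Submodule.mem_orthogonal_singleton_iff_inner_left).mp y.2
    rw [Submodule.coe_inner, inner_sub_right, inner_smul_right, hyv, mul_zero, sub_zero]

theorem inner_smul_add_orthogonal (v w : S n) (t : ℝ) (y : E n) :
    inner ℝ (t • (v : E n) + y) (w : E n) =
      t * inner ℝ (v : E n) (w : E n) + inner ℝ y (w : E n) := by
  rw [inner_add_left, inner_smul_left, conj_trivial]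

theorem inner_orthogonal_neg_self {v : S n} (y : (Submodule.span ℝ {(v : E n)})ᗮ) (t : ℝ) :
    inner ℝ (t • (v : E n) + y) ((-v : S n) : E n) = -t := by
  have hyv : inner ℝ (y : E n) (v : E n) = 0 :=
    (Submodule.mem_orthogonal_singleton_iff_inner_left).mp y.2
  have hcoe : ((-v : S n) : E n) = -(v : E n) := rfl
  rw [hcoe, inner_neg_right, inner_add_left, inner_smul_left, hyv, real_inner_self_eq_norm_sq]
  simp

/-- For w ≠ ±v the functional of w is nonzero on the slice and the ball estimate applies. For w = -v
it is constant there, and t > 0 keeps the distance b + t away from 0. -/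
theorem exists_lintegral_slice_le {v w : S n} (hne : w ≠ v) {b : ℝ} (hb : 0 < b) {a : ℝ}
    (ha : 0 < a) (ha1 : a < 1) (R : ℝ) :
    ∃ C : ℝ≥0∞, C ≠ ⊤ ∧ ∀ t : ℝ, 0 < t →
      ∫⁻ y in ball (0 : (Submodule.span ℝ {(v : E n)})ᗮ) R,
        ENNReal.ofReal (1 / (b - inner ℝ (t • (v : E n) + y) (w : E n))) ^ a ≤ C := by
  by_cases hneg : w = -v
  · subst hneg
    refine ⟨ENNReal.ofReal (1 / b) ^ a * volume (ball (0 : (Submodule.span ℝ {(v : E n)})ᗮ) R),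
      ENNReal.mul_ne_top (ENNReal.rpow_ne_top_of_nonneg ha.le ENNReal.ofReal_ne_top)
        measure_ball_lt_top.ne, fun t ht => ?_⟩
    rw [← setLIntegral_const]
    refine lintegral_mono fun y => ENNReal.rpow_le_rpow (ENNReal.ofReal_le_ofReal ?_) ha.le
    rw [inner_orthogonal_neg_self]
    exact one_div_le_one_div_of_le hb (by linarith)
  · obtain ⟨e, he, hey⟩ := exists_inner_eq_of_ne hne hneg
    obtain ⟨C, hC, hCle⟩ := lintegral_ball_one_div_rpow_le he ha ha1 R
    refine ⟨C, hC, fun t _ => ?_⟩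
    refine le_trans (le_of_eq ?_) (hCle (b - t * inner ℝ (v : E n) (w : E n)))
    refine lintegral_congr fun y => ?_
    rw [inner_smul_add_orthogonal, hey, sub_sub]

theorem ae_inner_slice_ne {v w : S n} (hne : w ≠ v) {b : ℝ} (hb : 0 < b) {t : ℝ} (ht : 0 < t) :
    ∀ᵐ y : (Submodule.span ℝ {(v : E n)})ᗮ, inner ℝ (t • (v : E n) + y) (w : E n) ≠ b := by
  by_cases hneg : w = -v
  · subst hneg
    refine Filter.Eventually.of_forall fun y => ?_
    rw [inner_orthogonal_neg_self]
    linarith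
  · obtain ⟨e, he, hey⟩ := exists_inner_eq_of_ne hne hneg
    rw [ae_iff]
    convert volume_hyperplane_eq_zero he (b - t * inner ℝ (v : E n) (w : E n)) using 3
    funext y
    rw [inner_smul_add_orthogonal, hey, not_not, eq_sub_iff_add_eq']

/-- The integrand of `sliceIntegral`, on the product of the slice and the sphere. -/
def sliceIntegrand (W : Finset (S n)) (v : S n) (q : ℝ) (h : S n → ℝ) (t : ℝ)
    (z : (Submodule.span ℝ {(v : E n)})ᗮ × S n) : ℝ≥0∞ :=
  (openPoly W h).indicator (fun x => invRadial W h x z.2 ^ (1 - q)) (t • (v : E n) + z.1)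

theorem measurable_sliceIntegrand (W : Finset (S n)) (v : S n) (q : ℝ) (h : S n → ℝ) (t : ℝ) :
    Measurable (sliceIntegrand W v q h t) := by
  have h1 : Measurable fun z : (Submodule.span ℝ {(v : E n)})ᗮ × S n =>
      t • (v : E n) + (z.1 : E n) := by fun_prop
  exact ((measurable_invRadial W h h1 measurable_snd).pow_const (1 - q)).indicator
    (h1 (measurableSet_openPoly W h))

/-- Without the constraint v the polyhedron may be unbounded, but the part below height T lies in
the bounded polytope whose support number at v is T. -/
theorem mem_ball_of_slice_mem (hε : 0 < ε)
    (hU : ∀ u : S n, ∃ w ∈ U, ε ≤ inner ℝ (u : E n) (w : E n)) {v : S n}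
    (h : S n → ℝ) (T : ℝ) :
    ∃ R : ℝ, ∀ t < T, ∀ y : (Submodule.span ℝ {(v : E n)})ᗮ,
      t • (v : E n) + (y : E n) ∈ openPoly (U.erase v) h →
      y ∈ ball (0 : (Submodule.span ℝ {(v : E n)})ᗮ) R ∧ ‖t • (v : E n) + (y : E n)‖ ≤ R := by
  refine ⟨(∑ w ∈ U, |Function.update h v T w|) / ε + 1, fun t ht y hy => ?_⟩
  have hyv : inner ℝ (y : E n) (v : E n) = 0 :=
    (Submodule.mem_orthogonal_singleton_iff_inner_left).mp y.2
  have hmem : t • (v : E n) + (y : E n) ∈ openPoly U (Function.update h v T) := by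
    intro w hw
    rcases eq_or_ne w v with rfl | hwv
    · rw [Function.update_self, inner_smul_add_orthogonal, hyv, real_inner_self_eq_norm_sq]
      simpa using ht
    · rw [Function.update_of_ne hwv]
      exact hy w (Finset.mem_erase.mpr ⟨hwv, hw⟩)
  have h1 := mem_ball_zero_iff.mp (openPoly_subset_ball hε hU _ hmem)
  refine ⟨?_, h1.le⟩
  rw [mem_ball_zero_iff]
  refine lt_of_le_of_lt ?_ h1
  have hsq : ‖t • (v : E n) + (y : E n)‖ ^ 2 = t ^ 2 + ‖(y : E n)‖ ^ 2 := by
    rw [norm_add_sq_real, inner_smul_left, real_inner_comm, hyv, norm_smul]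
    simp
  refine le_of_sq_le_sq ?_ (norm_nonneg _)
  rw [hsq]
  change ‖(y : E n)‖ ^ 2 ≤ _
  nlinarith [sq_nonneg t]

/-- Puts all heights on one finite measure space that does not depend on t, as Vitali's theorem
requires. -/
theorem sliceIntegral_eq_lintegral_prod {W : Finset (S n)} {v : S n} {h : S n → ℝ} {t R : ℝ}
    (hR : ∀ y : (Submodule.span ℝ {(v : E n)})ᗮ, t • (v : E n) + (y : E n) ∈ openPoly W h →
      y ∈ ball (0 : (Submodule.span ℝ {(v : E n)})ᗮ) R) (q : ℝ) :
    sliceIntegral W v q h t = ∫⁻ z, sliceIntegrand W v q h t z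
      ∂((volume.restrict (ball (0 : (Submodule.span ℝ {(v : E n)})ᗮ) R)).prod
        ((volume : Measure (E n)).toSphere.restrict (inwardDirections v))) := by
  have hm : Measurable (sliceIntegrand W v q h t) :=
    measurable_sliceIntegrand W v q h t
  rw [lintegral_prod _ hm.aemeasurable, sliceIntegral, ← lintegral_indicator measurableSet_ball]
  refine lintegral_congr fun y => ?_
  by_cases hy : t • (v : E n) + (y : E n) ∈ openPoly W h
  · rw [Set.indicator_of_mem hy, Set.indicator_of_mem (hR y hy)]
    simp only [sliceIntegrand, Set.indicator_of_mem hy, inwardIntegral]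
  · rw [Set.indicator_of_notMem hy]
    refine (Set.indicator_apply_eq_zero.mpr fun _ => ?_).symm
    simp only [sliceIntegrand, Set.indicator_of_notMem hy, lintegral_zero]

/-- An inward direction has u ⬝ v < 0, so the w with u ⬝ w ≥ ε differs from v and survives the
erasure. The pointwise bound then holds, and its singular terms integrate uniformly over the slices.
-/
theorem exists_sliceIntegral_le (hε : 0 < ε)
    (hU : ∀ u : S n, ∃ w ∈ U, ε ≤ inner ℝ (u : E n) (w : E n)) {q : ℝ} (hq : 0 < q)
    {h : S n → ℝ} (hh : ∀ w ∈ U, 0 < h w) (v : S n) (T : ℝ) :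
    ∃ C : ℝ≥0∞, C ≠ ⊤ ∧ ∀ t, 0 < t → t < T → sliceIntegral (U.erase v) v q h t ≤ C := by
  obtain ⟨a, ha, ha1, hbound⟩ := exists_invRadial_rpow_le (n := n) hq
  obtain ⟨R, hR⟩ := mem_ball_of_slice_mem (v := v) hε hU h T
  obtain ⟨C, hC, hCle⟩ := hbound (U.erase v) h ε ((∑ w ∈ U, |h w|) + R) hε
  have hD : ∀ w : S n, ∃ D : ℝ≥0∞, D ≠ ⊤ ∧ (w ∈ U.erase v → ∀ t : ℝ, 0 < t →
      ∫⁻ y in ball (0 : (Submodule.span ℝ {(v : E n)})ᗮ) R,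
        ENNReal.ofReal (1 / (h w - inner ℝ (t • (v : E n) + y) (w : E n))) ^ a ≤ D) := by
    intro w
    by_cases hw : w ∈ U.erase v
    · obtain ⟨D, hD, hDle⟩ := exists_lintegral_slice_le (Finset.ne_of_mem_erase hw)
        (hh w (Finset.mem_of_mem_erase hw)) ha ha1 R
      exact ⟨D, hD, fun _ => hDle⟩
    · exact ⟨0, ENNReal.zero_ne_top, fun h => absurd h hw⟩
  choose D hD hDle using hD
  set σ := (volume : Measure (E n)).toSphere
  refine ⟨(C * volume (ball (0 : (Submodule.span ℝ {(v : E n)})ᗮ) R) + ∑ w ∈ U.erase v, D w) *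
    σ (inwardDirections v), ?_, fun t ht htT => ?_⟩
  · exact ENNReal.mul_ne_top (ENNReal.add_ne_top.mpr ⟨ENNReal.mul_ne_top hC
      measure_ball_lt_top.ne, ENNReal.sum_ne_top.mpr fun w _ => hD w⟩) (measure_ne_top _ _)
  have hpt : ∀ y : (Submodule.span ℝ {(v : E n)})ᗮ,
      (openPoly (U.erase v) h).indicator (inwardIntegral (U.erase v) v q h) (t • (v : E n) + y) ≤
      (ball (0 : (Submodule.span ℝ {(v : E n)})ᗮ) R).indicator (fun y =>
        (C + ∑ w ∈ U.erase v, ENNReal.ofReal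
          (1 / (h w - inner ℝ (t • (v : E n) + y) (w : E n))) ^ a) * σ (inwardDirections v)) y := by
    intro y
    by_cases hy : t • (v : E n) + (y : E n) ∈ openPoly (U.erase v) h
    · obtain ⟨hy1, hy2⟩ := hR t htT y hy
      rw [Set.indicator_of_mem hy, Set.indicator_of_mem hy1, inwardIntegral, ← setLIntegral_const]
      refine setLIntegral_mono' (measurableSet_inwardDirections v) fun u hu => ?_
      refine hCle _ hy (fun w hw => ?_) u ?_
      · have h1 := Finset.single_le_sum (f := fun w => |h w|) (fun _ _ => abs_nonneg _)
          (Finset.mem_of_mem_erase hw)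
        have h2 := abs_inner_sphere_le (t • (v : E n) + (y : E n)) w
        have h4 := le_abs_self (h w)
        have h5 := neg_abs_le (inner ℝ (t • (v : E n) + (y : E n)) (w : E n))
        linarith
      · obtain ⟨w, hw, hle⟩ := hU u
        refine ⟨w, Finset.mem_erase.mpr ⟨?_, hw⟩, hle⟩
        rintro rfl
        exact absurd (mem_inwardDirections.mp hu) (by linarith)
    · rw [Set.indicator_of_notMem hy]; exact zero_le
  refine (lintegral_mono hpt).trans ?_
  rw [lintegral_indicator measurableSet_ball, lintegral_mul_const _ (by fun_prop),
    lintegral_add_left measurable_const, lintegral_finsetSum _ (fun w _ => by fun_prop),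
    setLIntegral_const]
  gcongr with w hw
  exact hDle w hw t ht

theorem tendsto_sliceIntegrand {W : Finset (S n)} {v : S n} {h : S n → ℝ} {t₀ : ℝ}
    {z : (Submodule.span ℝ {(v : E n)})ᗮ × S n}
    (hz : ∀ w ∈ W, inner ℝ (t₀ • (v : E n) + z.1) (w : E n) ≠ h w) (q : ℝ) :
    Filter.Tendsto (fun t => sliceIntegrand W v q h t z) (nhds t₀)
      (nhds (sliceIntegrand W v q h t₀ z)) := by
  have hc : Continuous fun t : ℝ => t • (v : E n) + (z.1 : E n) := by fun_prop
  by_cases hmem : t₀ • (v : E n) + (z.1 : E n) ∈ openPoly W h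
  · have hev : ∀ᶠ t in nhds t₀, t • (v : E n) + (z.1 : E n) ∈ openPoly W h :=
      hc.continuousAt.eventually ((isOpen_openPoly W h).mem_nhds hmem)
    have hcont : ContinuousAt (fun t : ℝ => invRadial W h (t • (v : E n) + z.1) z.2) t₀ := by
      refine ContinuousAt.finset_sup_apply fun w hw => ?_
      refine ENNReal.continuous_ofReal.continuousAt.comp ?_
      refine ContinuousAt.div continuousAt_const (by fun_prop) ?_
      exact (sub_pos.mpr (hmem w hw)).ne'
    have hcont2 := (ENNReal.continuous_rpow_const (y := 1 - q)).continuousAt.comp hcont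
    rw [sliceIntegrand, Set.indicator_of_mem hmem]
    refine hcont2.tendsto.congr' ?_
    filter_upwards [hev] with t ht
    rw [sliceIntegrand, Set.indicator_of_mem ht]
    rfl
  · have : ∃ w ∈ W, h w < inner ℝ (t₀ • (v : E n) + (z.1 : E n)) (w : E n) := by
      by_contra hcon
      push Not at hcon
      exact hmem fun w hw => lt_of_le_of_ne (hcon w hw) (hz w hw)
    obtain ⟨w, hw, hlt⟩ := this
    have hc2 : Continuous fun t : ℝ => inner ℝ (t • (v : E n) + (z.1 : E n)) (w : E n) := by fun_prop
    have hev := hc2.continuousAt.eventually (lt_mem_nhds hlt)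
    rw [sliceIntegrand, Set.indicator_of_notMem hmem]
    refine tendsto_const_nhds.congr' ?_
    filter_upwards [hev] with t ht
    rw [sliceIntegrand, Set.indicator_of_notMem fun h' => (h' w hw).not_gt ht]

/-- The integral over the slices orthogonal to `v` depends continuously on the height. -/
theorem continuousAt_sliceIntegral (hε : 0 < ε)
    (hU : ∀ u : S n, ∃ w ∈ U, ε ≤ inner ℝ (u : E n) (w : E n)) {q : ℝ} (hq : 0 < q)
    {h : S n → ℝ} (hh : ∀ w ∈ U, 0 < h w) (v : S n) {t₀ : ℝ} (ht₀ : 0 < t₀) :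
    ContinuousAt (sliceIntegral (U.erase v) v q h) t₀ := by
  obtain ⟨R, hR⟩ := mem_ball_of_slice_mem (v := v) hε hU h (t₀ + 1)
  -- Vitali is applied with δ = q. Since (1 - q)(1 + q) = 1 - q², the power 1 + q of the integrand
  -- is the same integrand with q² > 0 in place of q, and the uniform bound covers it.
  obtain ⟨C, hC, hCle⟩ := exists_sliceIntegral_le hε hU (sq_pos_of_pos hq) hh v (t₀ + 1)
  set W := U.erase v
  set ν := (volume.restrict (ball (0 : (Submodule.span ℝ {(v : E n)})ᗮ) R)).prod
        ((volume : Measure (E n)).toSphere.restrict (inwardDirections v)) with hν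
  have : IsFiniteMeasure (volume.restrict (ball (0 : (Submodule.span ℝ {(v : E n)})ᗮ) R)) :=
    ⟨by simpa using measure_ball_lt_top⟩
  have hm : ∀ q t, Measurable (sliceIntegrand W v q h t) := fun q t =>
    measurable_sliceIntegrand W v q h t
  have hpow : ∀ t z, sliceIntegrand W v q h t z ^ (1 + q) = sliceIntegrand W v (q ^ 2) h t z := by
    intro t z
    unfold sliceIntegrand
    by_cases hz : t • (v : E n) + (z.1 : E n) ∈ openPoly W h
    · rw [Set.indicator_of_mem hz, Set.indicator_of_mem hz, ← ENNReal.rpow_mul]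
      congr 1; ring
    · rw [Set.indicator_of_notMem hz, Set.indicator_of_notMem hz, ENNReal.zero_rpow_of_pos]
      linarith
  have hnear : ∀ᶠ t in nhds t₀, 0 < t ∧ t < t₀ + 1 :=
    Ioo_mem_nhds ht₀ (by linarith)
  have heq : ∀ q t, t < t₀ + 1 → sliceIntegral W v q h t = ∫⁻ z, sliceIntegrand W v q h t z ∂ν :=
    fun q t ht => sliceIntegral_eq_lintegral_prod (fun y hy => (hR t ht y hy).1) q
  have hbd : ∀ t, 0 < t → t < t₀ + 1 → ∫⁻ z, sliceIntegrand W v q h t z ^ (1 + q) ∂ν ≤ C := by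
    intro t h0 h1
    simp_rw [hpow]
    rw [← heq _ t h1]
    exact hCle t h0 h1
  have hae : ∀ᵐ z ∂ν, ∀ w ∈ W, inner ℝ (t₀ • (v : E n) + z.1) (w : E n) ≠ h w := by
    refine (ae_ball_iff W.countable_toSet).mpr fun w hw => ?_
    have hwW : w ∈ W := hw
    have h1 := ae_inner_slice_ne (Finset.ne_of_mem_erase hwW) (hh w (Finset.mem_of_mem_erase hwW)) ht₀
    exact Measure.quasiMeasurePreserving_fst.ae (ae_restrict_of_ae h1)
  have hlim := tendsto_lintegral_of_lintegral_rpow_le (ν := ν) (l := nhds t₀)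
    (F := fun t => sliceIntegrand W v q h t) (F₀ := sliceIntegrand W v q h t₀)
    (Filter.Eventually.of_forall fun t => hm q t)
    (hae.mono fun z hz => tendsto_sliceIntegrand hz q) hq hC
    (hnear.mono fun t ht => hbd t ht.1 ht.2) (hbd t₀ ht₀ (by linarith)) (hm q t₀)
  rw [ContinuousAt, heq q t₀ (by linarith)]
  refine hlim.congr' ?_
  filter_upwards [hnear] with t ht
  rw [heq q t ht.2]

theorem measurable_sliceIntegral (W : Finset (S n)) (v : S n) (q : ℝ) (h : S n → ℝ) :
    Measurable (sliceIntegral W v q h) := by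
  have h1 : Measurable fun z : ℝ × (Submodule.span ℝ {(v : E n)})ᗮ =>
      z.1 • (v : E n) + (z.2 : E n) := by fun_prop
  exact Measurable.lintegral_prod_right' (f := fun z : ℝ × (Submodule.span ℝ {(v : E n)})ᗮ =>
    (openPoly W h).indicator (inwardIntegral W v q h) (z.1 • (v : E n) + (z.2 : E n)))
    (((measurable_inwardIntegral W v q h).indicator (measurableSet_openPoly W h)).comp h1)

/-- The partial derivatives of the chord integral with respect to the support numbers. -/
theorem hasDerivAt_chordIntegral (hε : 0 < ε)
    (hU : ∀ u : S n, ∃ w ∈ U, ε ≤ inner ℝ (u : E n) (w : E n)) {q : ℝ} (hq : 0 < q)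
    {h : S n → ℝ} (hh : ∀ w ∈ U, 0 < h w) {v : S n} (hv : v ∈ U) :
    HasDerivAt (fun τ => (chordIntegral U q (Function.update h v τ)).toReal)
      (2 * (sliceIntegral (U.erase v) v q h (h v)).toReal) (h v) := by
  set k := sliceIntegral (U.erase v) v q h with hk
  have hkm : Measurable k := measurable_sliceIntegral _ _ _ _
  have hG : ∀ τ, chordIntegral U q (Function.update h v τ) = 2 * ∫⁻ t in Set.Iic τ, k t := by
    intro τ
    rw [chordIntegral_update hε hU q hv]
    congr 1
    exact setLIntegral_congr Iio_ae_eq_Iic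
  have hfin : ∀ τ, ∫⁻ t in Set.Iic τ, k t ≠ ⊤ := by
    intro τ htop
    have := chordIntegral_lt_top hε hU hq (Function.update h v τ)
    rw [hG, htop] at this
    simp at this
  have hint : ∀ τ, IntegrableOn (fun t => (k t).toReal) (Set.Iic τ) := fun τ =>
    integrable_toReal_of_lintegral_ne_top hkm.aemeasurable (hfin τ)
  have hreal : ∀ τ, (chordIntegral U q (Function.update h v τ)).toReal =
      2 * ∫ t in Set.Iic τ, (k t).toReal := by
    intro τ
    rw [hG, ENNReal.toReal_mul, integral_toReal hkm.aemeasurable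
      (ae_lt_top hkm (hfin τ))]
    simp
  obtain ⟨C, hC, hCle⟩ := exists_sliceIntegral_le hε hU hq hh v (h v + 1)
  have hkfin : k (h v) ≠ ⊤ := ne_top_of_le_ne_top hC (hCle _ (hh v hv) (by linarith))
  have hcont : ContinuousAt (fun t => (k t).toReal) (h v) :=
    (ENNReal.continuousAt_toReal hkfin).comp (continuousAt_sliceIntegral hε hU hq hh v (hh v hv))
  have hderiv : HasDerivAt (fun τ => ∫ t in (h v - 1)..τ, (k t).toReal) ((k (h v)).toReal) (h v) := by
    refine intervalIntegral.integral_hasDerivAt_right ?_ ?_ hcont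
    · rw [intervalIntegrable_iff_integrableOn_Ioc_of_le (by linarith)]
      exact (hint (h v)).mono_set Set.Ioc_subset_Iic_self
    · exact (hkm.ennreal_toReal.stronglyMeasurable).stronglyMeasurableAtFilter
  have h2 : (fun τ => (chordIntegral U q (Function.update h v τ)).toReal) = fun τ =>
      2 * ((∫ t in Set.Iic (h v - 1), (k t).toReal) + ∫ t in (h v - 1)..τ, (k t).toReal) := by
    funext τ
    rw [hreal, ← intervalIntegral.integral_Iic_sub_Iic (hint _) (hint _)]
    ring
  rw [h2]
  exact (hderiv.const_add _).const_mul 2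

end Derivative

/-! ### Consequences of general position -/

section GeneralPosition

open scoped Classical

variable {n : ℕ} {U : Finset (S n)}

theorem eq_zero_or_exists_smul (x : E n) : x = 0 ∨ ∃ u : S n, x = ‖x‖ • (u : E n) := by
  rcases eq_or_ne x 0 with hx | hx
  · exact Or.inl hx
  · have hpos : 0 < ‖x‖ := norm_pos_iff.mpr hx
    refine Or.inr ⟨⟨‖x‖⁻¹ • x, by simp [norm_smul, inv_mul_cancel₀ hpos.ne']⟩, ?_⟩
    simp only
    rw [smul_inv_smul₀ hpos.ne']

theorem nonempty_sphere (hn : 1 ≤ n) : Nonempty (S n) := by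
  have : Nonempty (Fin n) := ⟨⟨0, hn⟩⟩
  exact (NormedSpace.sphere_nonempty.mpr zero_le_one).to_subtype

theorem InGeneralPosition.nonempty (hn : 1 ≤ n) (hU : InGeneralPosition U) : U.Nonempty := by
  rw [Finset.nonempty_iff_ne_empty]
  rintro rfl
  obtain ⟨u⟩ := nonempty_sphere hn
  exact hU.1 ⟨u, by simp⟩

theorem InGeneralPosition.exists_inner_pos (hU : InGeneralPosition U) (u : S n) :
    ∃ w ∈ U, 0 < inner ℝ (u : E n) (w : E n) := by
  by_contra hcon
  push Not at hcon
  refine hU.1 ⟨-u, fun w hw => ?_⟩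
  have hcoe : ((-u : S n) : E n) = -(u : E n) := rfl
  rw [hcoe, inner_neg_left]
  linarith [hcon w hw]

/-- The maximum over U of u ⬝ w is continuous and positive on the compact sphere; ε is its minimum.
-/
theorem InGeneralPosition.exists_le_inner (hn : 1 ≤ n) (hU : InGeneralPosition U) :
    ∃ ε : ℝ, 0 < ε ∧ ∀ u : S n, ∃ w ∈ U, ε ≤ inner ℝ (u : E n) (w : E n) := by
  have hne := hU.nonempty hn
  have := nonempty_sphere hn
  set f : S n → ℝ := fun u => U.sup' hne fun w => inner ℝ (u : E n) (w : E n) with hf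
  have hcont : Continuous f := Continuous.finset_sup'_apply hne fun w _ => by fun_prop
  obtain ⟨u₀, -, hmin⟩ := isCompact_univ.exists_isMinOn Set.univ_nonempty hcont.continuousOn
  refine ⟨f u₀, ?_, fun u => ?_⟩
  · obtain ⟨w, hw, hpos⟩ := hU.exists_inner_pos u₀
    exact hpos.trans_le (Finset.le_sup' (fun w : S n => inner ℝ (u₀ : E n) (w : E n)) hw)
  · obtain ⟨w, hw, heq⟩ := Finset.exists_mem_eq_sup' hne fun w : S n => inner ℝ (u : E n) (w : E n)
    exact ⟨w, hw, heq ▸ hmin (Set.mem_univ u)⟩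

/-- Fewer than n vectors do not span, and a unit vector orthogonal to their span has no positive
inner product with any of them. -/
theorem InGeneralPosition.le_card (hU : InGeneralPosition U) : n ≤ U.card := by
  by_contra hlt
  push Not at hlt
  set L := Submodule.span ℝ ((U.image fun v : S n => (v : E n) : Finset (E n)) : Set (E n)) with hL
  have hrank : Module.finrank ℝ L < n :=
    (finrank_span_finset_le_card _).trans_lt (Finset.card_image_le.trans_lt hlt)
  have hbot : Lᗮ ≠ ⊥ := by
    intro h
    rw [Submodule.orthogonal_eq_bot_iff] at h
    rw [h, finrank_top, finrank_euclideanSpace_fin] at hrank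
    exact lt_irrefl _ hrank
  obtain ⟨x, hx, hx0⟩ := Submodule.exists_mem_ne_zero_of_ne_bot hbot
  rcases eq_zero_or_exists_smul x with h0 | ⟨u, hu⟩
  · exact hx0 h0
  · obtain ⟨w, hw, hpos⟩ := hU.exists_inner_pos u
    have h1 : inner ℝ x (w : E n) = 0 := by
      refine Submodule.inner_left_of_mem_orthogonal (Submodule.subset_span ?_) hx
      simpa using hw
    rw [hu, inner_smul_left, conj_trivial] at h1
    have : 0 < ‖x‖ := norm_pos_iff.mpr hx0
    exact (mul_pos this hpos).ne' h1

/-- For a linear dependency among vectors in general position, some term has positive inner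
product with any given direction. -/
theorem InGeneralPosition.exists_mul_inner_pos (hU : InGeneralPosition U) {β : S n → ℝ}
    (hsum : ∑ v ∈ U, β v • (v : E n) = 0) (hne : ∃ v ∈ U, β v ≠ 0) (u : S n) :
    ∃ v ∈ U, 0 < β v * inner ℝ (u : E n) (v : E n) := by
  by_contra hcon
  push Not at hcon
  have hzero : ∑ v ∈ U, β v * inner ℝ (u : E n) (v : E n) = 0 := by
    have := congrArg (fun x => inner ℝ (u : E n) x) hsum
    simpa [inner_sum, inner_smul_right] using this
  -- All terms are nonpositive with sum 0, hence all vanish, and u is orthogonal to every v with β v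
  -- ≠ 0. If there are at least n of these, n of them span and u = 0. Otherwise they extend to n
  -- independent elements of U, and the relation forces β = 0.
  have hall := (Finset.sum_eq_zero_iff_of_nonpos hcon).mp hzero
  set A := U.filter fun v => β v ≠ 0 with hA
  have hAU : A ⊆ U := Finset.filter_subset _ _
  have hperp : ∀ v ∈ A, inner ℝ (u : E n) (v : E n) = 0 := fun v hv =>
    (mul_eq_zero.mp (hall v (hAU hv))).resolve_left (Finset.mem_filter.mp hv).2
  rcases le_or_gt n A.card with hcard | hcard
  · obtain ⟨T, hTA, hTn⟩ := Finset.exists_subset_card_eq hcard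
    have hli := hU.2 T (hTA.trans hAU) hTn
    have hspan := hli.span_eq_top_of_card_eq_finrank' (by simp [hTn])
    have hle : Submodule.span ℝ (Set.range fun v : T => ((v : S n) : E n)) ≤
        (Submodule.span ℝ {(u : E n)})ᗮ := by
      rw [Submodule.span_le]
      rintro _ ⟨v, rfl⟩
      exact (Submodule.mem_orthogonal_singleton_iff_inner_right).mpr (hperp _ (hTA v.2))
    rw [hspan] at hle
    have huu := (Submodule.mem_orthogonal_singleton_iff_inner_right).mp
      (hle (Submodule.mem_top (x := (u : E n))))
    exact ne_zero_of_mem_unit_sphere u (inner_self_eq_zero.mp huu)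
  · obtain ⟨T, hAT, hTU, hTn⟩ := Finset.exists_subsuperset_card_eq hAU hcard.le hU.le_card
    have hli := hU.2 T hTU hTn
    have hTsum : ∑ v : T, β v • ((v : S n) : E n) = 0 := by
      rw [Finset.sum_coe_sort T fun v => β v • (v : E n)]
      refine Eq.trans ?_ hsum
      refine Finset.sum_subset hTU fun v hvU hvT => ?_
      have : β v = 0 := by
        by_contra h0
        exact hvT (hAT (Finset.mem_filter.mpr ⟨hvU, h0⟩))
      rw [this, zero_smul]
    have hz := Fintype.linearIndependent_iff.mp hli (fun v => β v) hTsum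
    obtain ⟨v, hv, hv0⟩ := hne
    exact hv0 (hz ⟨v, hAT (Finset.mem_filter.mpr ⟨hv, hv0⟩)⟩)

/-- Nonnegative relations with maximal coefficient 1 form a compact set, so the positivity in
`InGeneralPosition.exists_mul_inner_pos` becomes uniform in the relation and in u. -/
theorem InGeneralPosition.exists_le_mul_inner (hn : 1 ≤ n) (hU : InGeneralPosition U) :
    ∃ ε : ℝ, 0 < ε ∧ ∀ β : S n → ℝ, (∀ v ∈ U, 0 ≤ β v ∧ β v ≤ 1) → (∃ v ∈ U, β v = 1) →
      ∑ v ∈ U, β v • (v : E n) = 0 → ∀ u : S n, ∃ v ∈ U, ε ≤ β v * inner ℝ (u : E n) (v : E n) := by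
  have hne := hU.nonempty hn
  -- Coefficients are functions on the whole sphere, and B is compact by Tychonoff. Values off U are
  -- irrelevant; `hclip` sets them to 0 to land in B.
  set B : Set (S n → ℝ) := (Set.univ.pi fun _ => Set.Icc 0 1) ∩
    ({β | ∑ v ∈ U, β v • (v : E n) = 0} ∩ ⋃ v ∈ U, {β | β v = 1}) with hB
  have hBc : IsCompact B := by
    refine (isCompact_univ_pi fun _ => isCompact_Icc).inter_right (IsClosed.inter ?_ ?_)
    · exact isClosed_eq (by fun_prop) continuous_const
    · exact isClosed_biUnion_finset fun v _ => isClosed_eq (continuous_apply v) continuous_const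
  set f : (S n → ℝ) × S n → ℝ := fun z => U.sup' hne fun w => z.1 w * inner ℝ (z.2 : E n) (w : E n)
    with hf
  have hcont : Continuous f := Continuous.finset_sup'_apply hne fun w _ => by fun_prop
  have hclip : ∀ β : S n → ℝ, (∀ v ∈ U, 0 ≤ β v ∧ β v ≤ 1) → (∃ v ∈ U, β v = 1) →
      ∑ v ∈ U, β v • (v : E n) = 0 → (fun v => if v ∈ U then β v else 0) ∈ B := by
    intro β h01 h1 hsum
    refine ⟨fun v _ => ?_, ?_, ?_⟩
    · by_cases hv : v ∈ U
      · simpa [hv] using h01 v hv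
      · simp [hv]
    · exact (Finset.sum_congr rfl fun v hv => by simp [hv]).trans hsum
    · obtain ⟨v, hv, hv1⟩ := h1
      exact Set.mem_biUnion hv (by simpa [hv] using hv1)
  rcases (B ×ˢ (Set.univ : Set (S n))).eq_empty_or_nonempty with hemp | hnonemp
  · refine ⟨1, one_pos, fun β h01 h1 hsum u => ?_⟩
    exact absurd (Set.mk_mem_prod (hclip β h01 h1 hsum) (Set.mem_univ u))
      (by rw [hemp]; exact Set.notMem_empty _)
  · obtain ⟨⟨β₀, u₀⟩, ⟨hβ₀, -⟩, hmin⟩ := (hBc.prod isCompact_univ).exists_isMinOn hnonemp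
      hcont.continuousOn
    refine ⟨f (β₀, u₀), ?_, fun β h01 h1 hsum u => ?_⟩
    · obtain ⟨-, hb2, hb3⟩ := hβ₀
      obtain ⟨v, hv, hv1⟩ := Set.mem_iUnion₂.mp hb3
      obtain ⟨w, hw, hpos⟩ := hU.exists_mul_inner_pos hb2
        ⟨v, hv, by
          have h1 : β₀ v = 1 := hv1
          simp [h1]⟩ u₀
      exact hpos.trans_le (Finset.le_sup' (fun w : S n => β₀ w * inner ℝ (u₀ : E n) (w : E n)) hw)
    · have hle := hmin (Set.mk_mem_prod (hclip β h01 h1 hsum) (Set.mem_univ u))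
      obtain ⟨w, hw, heq⟩ := Finset.exists_mem_eq_sup' hne fun w : S n =>
        (if w ∈ U then β w else 0) * inner ℝ (u : E n) (w : E n)
      refine ⟨w, hw, ?_⟩
      have h2 : f (β₀, u₀) ≤ U.sup' hne fun w : S n =>
        (if w ∈ U then β w else 0) * inner ℝ (u : E n) (w : E n) := hle
      rw [heq, if_pos hw] at h2
      exact h2

end GeneralPosition

/-! ### Balanced translates and a priori bounds on support numbers -/

section Normalization

open scoped Classical

variable {n : ℕ} {U : Finset (S n)} {α : S n → ℝ} {p : ℝ}

/-- The functional `∑ α v * h v ^ p` of the support numbers. -/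
def energy (U : Finset (S n)) (α : S n → ℝ) (p : ℝ) (h : S n → ℝ) : ℝ := ∑ v ∈ U, α v * h v ^ p

/-- The origin is a critical point of `ξ ↦ ∑ α v * (h v - ξ ⬝ v) ^ p`. -/
def IsBalanced (U : Finset (S n)) (α : S n → ℝ) (p : ℝ) (h : S n → ℝ) : Prop :=
  ∑ v ∈ U, (α v * h v ^ (p - 1)) • (v : E n) = 0

theorem energy_pos (hne : U.Nonempty) (hα : ∀ v ∈ U, 0 < α v) {h : S n → ℝ}
    (hh : ∀ v ∈ U, 0 < h v) : 0 < energy U α p h :=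
  Finset.sum_pos (fun v hv => mul_pos (hα v hv) (Real.rpow_pos_of_pos (hh v hv) _)) hne

theorem energy_const_mul {h : S n → ℝ} (hh : ∀ v ∈ U, 0 < h v) {c : ℝ} (hc : 0 < c) :
    energy U α p (fun v => c * h v) = c ^ p * energy U α p h := by
  rw [energy, energy, Finset.mul_sum]
  refine Finset.sum_congr rfl fun v hv => ?_
  rw [Real.mul_rpow hc.le (hh v hv).le]; ring

theorem IsBalanced.const_mul {h : S n → ℝ} (hb : IsBalanced U α p h) (hh : ∀ v ∈ U, 0 < h v)
    {c : ℝ} (hc : 0 < c) : IsBalanced U α p fun v => c * h v := by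
  have : ∑ v ∈ U, (α v * (c * h v) ^ (p - 1)) • (v : E n) =
      c ^ (p - 1) • ∑ v ∈ U, (α v * h v ^ (p - 1)) • (v : E n) := by
    rw [Finset.smul_sum]
    refine Finset.sum_congr rfl fun v hv => ?_
    rw [Real.mul_rpow hc.le (hh v hv).le, smul_smul]
    congr 1; ring
  rw [IsBalanced, this, hb, smul_zero]

/-- Convexity of x ↦ x^p. After scaling to a = 1 it is 1 + p (x - 1) ≤ 1 + p log x ≤ exp (p log x),
where p < 0 reverses log x ≤ x - 1. -/
theorem rpow_tangent_le (hp : p < 0) {a b : ℝ} (ha : 0 < a) (hb : 0 < b) :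
    a ^ p + p * a ^ (p - 1) * (b - a) ≤ b ^ p := by
  have hx : 0 < b / a := div_pos hb ha
  have h1 : 1 + p * (b / a - 1) ≤ (b / a) ^ p := by
    rw [Real.rpow_def_of_pos hx]
    have h2 := Real.add_one_le_exp (Real.log (b / a) * p)
    have h3 := Real.log_le_sub_one_of_pos hx
    nlinarith
  rw [Real.div_rpow hb.le ha.le, le_div_iff₀ (Real.rpow_pos_of_pos ha p)] at h1
  have h4 : a ^ (p - 1) = a ^ p / a := Real.rpow_sub_one ha.ne' p
  calc a ^ p + p * a ^ (p - 1) * (b - a) = (1 + p * (b / a - 1)) * a ^ p := by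
        rw [h4]; field_simp
    _ ≤ b ^ p := h1

/-- The tangent plane inequality for the energy at balanced support numbers, invariant under
translations. -/
theorem IsBalanced.energy_tangent_le (hp : p < 0) (hα : ∀ v ∈ U, 0 < α v) {g h : S n → ℝ}
    (hb : IsBalanced U α p g) (hg : ∀ v ∈ U, 0 < g v) {ξ : E n}
    (hξ : ∀ v ∈ U, 0 < h v - inner ℝ ξ (v : E n)) :
    energy U α p g + ∑ v ∈ U, α v * p * g v ^ (p - 1) * (h v - g v) ≤
      energy U α p fun v => h v - inner ℝ ξ (v : E n) := by
  -- Pairing the balance relation with ξ: the first-order effect of the translation vanishes.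
  have hzero : ∑ v ∈ U, α v * g v ^ (p - 1) * inner ℝ ξ (v : E n) = 0 := by
    have := congrArg (fun x => inner ℝ ξ x) hb
    simpa [inner_sum, inner_smul_right] using this
  have hle : ∀ v ∈ U, α v * (g v ^ p + p * g v ^ (p - 1) * (h v - inner ℝ ξ (v : E n) - g v)) ≤
      α v * (h v - inner ℝ ξ (v : E n)) ^ p := fun v hv =>
    mul_le_mul_of_nonneg_left (rpow_tangent_le hp (hg v hv) (hξ v hv)) (hα v hv).le
  refine le_trans (le_of_eq ?_) (Finset.sum_le_sum hle)
  have hsplit : ∀ v ∈ U,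
      α v * (g v ^ p + p * g v ^ (p - 1) * (h v - inner ℝ ξ (v : E n) - g v)) =
      α v * g v ^ p + α v * p * g v ^ (p - 1) * (h v - g v)
        - p * (α v * g v ^ (p - 1) * inner ℝ ξ (v : E n)) := fun v _ => by ring
  rw [Finset.sum_congr rfl hsplit, Finset.sum_sub_distrib, Finset.sum_add_distrib,
    ← Finset.mul_sum, hzero, mul_zero, sub_zero, energy]

/-- Polytopes with balanced support numbers are uniformly bounded in terms of each of them. -/
theorem InGeneralPosition.exists_norm_le (hn : 1 ≤ n) (hU : InGeneralPosition U) (hp : p < 0)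
    (hα : ∀ v ∈ U, 0 < α v) :
    ∃ C : ℝ, ∀ h : S n → ℝ, (∀ v ∈ U, 0 < h v) → IsBalanced U α p h →
      ∀ x ∈ openPoly U h, ∀ w ∈ U, ‖x‖ ≤ C * h w := by
  have hne := hU.nonempty hn
  obtain ⟨ε, hε, hβ⟩ := hU.exists_le_mul_inner hn
  obtain ⟨v₁, hv₁, hmin⟩ := U.exists_min_image α hne
  obtain ⟨v₂, hv₂, hmax⟩ := U.exists_max_image α hne
  refine ⟨α v₂ / α v₁ / ε, fun h hh hb x hx w hw => ?_⟩
  have ha₁ := hα v₁ hv₁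
  have ha₂ := hα v₂ hv₂
  have hC : 0 < α v₂ / α v₁ / ε := by positivity
  obtain ⟨w₀, hw₀, hw₀min⟩ := U.exists_min_image h hne
  suffices h1 : ‖x‖ ≤ α v₂ / α v₁ / ε * h w₀ from
    h1.trans (mul_le_mul_of_nonneg_left (hw₀min w hw) hC.le)
  have hpos₀ := hh w₀ hw₀
  rcases eq_zero_or_exists_smul x with rfl | ⟨u, hu⟩
  · rw [norm_zero]; positivity
  obtain ⟨v₀, hv₀, hv₀max⟩ := U.exists_max_image (fun v => α v * h v ^ (p - 1)) hne
  set M := α v₀ * h v₀ ^ (p - 1) with hM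
  have hMpos : 0 < M := mul_pos (hα v₀ hv₀) (Real.rpow_pos_of_pos (hh v₀ hv₀) _)
  -- The balance relation divided by its largest coefficient M. For the v found, ε ‖x‖ ≤ (α v * h v
  -- ^ (p - 1) / M) * h v = α v * h v ^ p / M. With w₀ minimizing h, p < 0 gives h v ^ p ≤ h w₀ ^ p,
  -- and M ≥ α v₁ * h w₀ ^ (p - 1), so one factor h w₀ remains.
  obtain ⟨v, hv, hle⟩ := hβ (fun v => α v * h v ^ (p - 1) / M)
    (fun v hv => ⟨div_nonneg (mul_nonneg (hα v hv).le (Real.rpow_nonneg (hh v hv).le _)) hMpos.le,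
      (div_le_one hMpos).mpr (hv₀max v hv)⟩) ⟨v₀, hv₀, div_self hMpos.ne'⟩ (by
      have : ∀ v ∈ U, (α v * h v ^ (p - 1) / M) • (v : E n) =
          M⁻¹ • ((α v * h v ^ (p - 1)) • (v : E n)) := fun v _ => by
        rw [smul_smul]; congr 1; ring
      rw [Finset.sum_congr rfl this, ← Finset.smul_sum, hb, smul_zero]) u
  have hhv := hh v hv
  have hxv : ‖x‖ * inner ℝ (u : E n) (v : E n) < h v := by
    have := hx v hv
    rwa [hu, inner_smul_left, conj_trivial] at this
  have hc : 0 ≤ α v * h v ^ (p - 1) / M :=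
    div_nonneg (mul_nonneg (hα v hv).le (Real.rpow_nonneg hhv.le _)) hMpos.le
  have h2 : ε * ‖x‖ ≤ α v * h v ^ (p - 1) / M * h v := by
    calc ε * ‖x‖ ≤ α v * h v ^ (p - 1) / M * inner ℝ (u : E n) (v : E n) * ‖x‖ :=
          mul_le_mul_of_nonneg_right hle (norm_nonneg _)
      _ = α v * h v ^ (p - 1) / M * (‖x‖ * inner ℝ (u : E n) (v : E n)) := by ring
      _ ≤ _ := mul_le_mul_of_nonneg_left hxv.le hc
  have h3 : α v * h v ^ (p - 1) / M * h v = α v * h v ^ p / M := by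
    rw [Real.rpow_sub_one hhv.ne']; field_simp
  have h4 : h v ^ p ≤ h w₀ ^ p := Real.rpow_le_rpow_of_nonpos hpos₀ (hw₀min v hv) hp.le
  have h5 : α v₁ * h w₀ ^ (p - 1) ≤ M :=
    (mul_le_mul_of_nonneg_right (hmin w₀ hw₀) (Real.rpow_nonneg hpos₀.le _)).trans (hv₀max w₀ hw₀)
  have hpw : 0 < h w₀ ^ p := Real.rpow_pos_of_pos hpos₀ _
  have h6 : α v * h v ^ p / M ≤ α v₂ * h w₀ ^ p / (α v₁ * h w₀ ^ (p - 1)) := by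
    have hpw1 : 0 < h w₀ ^ (p - 1) := Real.rpow_pos_of_pos hpos₀ _
    exact div_le_div₀ (by positivity)
      (mul_le_mul (hmax v hv) h4 (Real.rpow_nonneg hhv.le _) ha₂.le) (by positivity) h5
  have h7 : α v₂ * h w₀ ^ p / (α v₁ * h w₀ ^ (p - 1)) = α v₂ / α v₁ * h w₀ := by
    rw [Real.rpow_sub_one hpos₀.ne']; field_simp
  rw [h3] at h2
  rw [div_mul_eq_mul_div, le_div_iff₀' hε]
  linarith

theorem exists_add_smul_mem_openPoly {h : S n → ℝ} {x : E n} (hx : x ∈ openPoly U h) (y : E n) :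
    ∃ δ : ℝ, 0 < δ ∧ x + δ • y ∈ openPoly U h := by
  have hc : Continuous fun t : ℝ => x + t • y := by fun_prop
  have hev : ∀ᶠ t in nhdsWithin (0 : ℝ) (Set.Ioi 0), x + t • y ∈ openPoly U h := by
    refine nhdsWithin_le_nhds (hc.continuousAt.eventually ((isOpen_openPoly U h).mem_nhds ?_))
    simpa using hx
  obtain ⟨t, ht, ht0⟩ := (hev.and self_mem_nhdsWithin).exists
  exact ⟨t, ht0, ht⟩

theorem inner_sphere_self (w : S n) : inner ℝ (w : E n) (w : E n) = 1 := by
  rw [real_inner_self_eq_norm_sq]; simp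

/-- Support numbers can be lowered to the values of the support function. -/
theorem exists_tight {h : S n → ℝ} (hh : ∀ w ∈ U, 0 < h w) :
    ∃ g : S n → ℝ, (∀ w ∈ U, 0 < g w ∧ g w ≤ h w) ∧ openPoly U g = openPoly U h ∧
      ∀ w ∈ U, ∀ c, (∀ x ∈ openPoly U g, inner ℝ x (w : E n) ≤ c) → g w ≤ c := by
  have h0 : (0 : E n) ∈ openPoly U h := fun w hw => by simpa using hh w hw
  set g : S n → ℝ := fun w => sSup ((fun x => inner ℝ x (w : E n)) '' openPoly U h) with hg
  have hbdd : ∀ w ∈ U, BddAbove ((fun x => inner ℝ x (w : E n)) '' openPoly U h) := by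
    rintro w hw
    exact ⟨h w, by rintro _ ⟨x, hx, rfl⟩; exact (hx w hw).le⟩
  have hlt : ∀ w ∈ U, ∀ x ∈ openPoly U h, inner ℝ x (w : E n) < g w := by
    intro w hw x hx
    obtain ⟨δ, hδ, hmem⟩ := exists_add_smul_mem_openPoly hx (w : E n)
    have h1 := le_csSup (hbdd w hw) ⟨_, hmem, rfl⟩
    simp only [inner_add_left, inner_smul_left, inner_sphere_self, conj_trivial, mul_one] at h1
    linarith
  have hle : ∀ w ∈ U, g w ≤ h w := fun w hw =>
    csSup_le ⟨_, 0, h0, rfl⟩ (by rintro _ ⟨x, hx, rfl⟩; exact (hx w hw).le)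
  have heq : openPoly U g = openPoly U h := by
    ext x
    exact ⟨fun hx w hw => (hx w hw).trans_le (hle w hw), fun hx w hw => hlt w hw x hx⟩
  refine ⟨g, fun w hw => ⟨?_, hle w hw⟩, heq, fun w hw c hc => ?_⟩
  · simpa using hlt w hw 0 h0
  · rw [heq] at hc
    exact csSup_le ⟨_, 0, h0, rfl⟩ (by rintro _ ⟨x, hx, rfl⟩; exact hc x hx)

/-- Since p < 0, one small distance alone makes the energy exceed its value at 0. The minimum over a
compact set of points far enough from all hyperplanes is therefore global. -/
theorem exists_translation_minimizer {ε : ℝ} (hε : 0 < ε)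
    (hU : ∀ u : S n, ∃ w ∈ U, ε ≤ inner ℝ (u : E n) (w : E n)) (hne : U.Nonempty) (hp : p < 0)
    (hα : ∀ v ∈ U, 0 < α v) {h : S n → ℝ} (hh : ∀ w ∈ U, 0 < h w) :
    ∃ ξ ∈ openPoly U h, ∀ ζ ∈ openPoly U h,
      energy U α p (fun v => h v - inner ℝ ξ (v : E n)) ≤
        energy U α p (fun v => h v - inner ℝ ζ (v : E n)) := by
  set Φ : E n → ℝ := fun ζ => energy U α p (fun v => h v - inner ℝ ζ (v : E n)) with hΦ
  have h0 : ∀ w ∈ U, 0 < h w - inner ℝ (0 : E n) (w : E n) := fun w hw => by simpa using hh w hw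
  have hM : 0 < Φ 0 := energy_pos hne hα h0
  have hM0 : Φ 0 = energy U α p h := by simp [hΦ]
  -- The second entry is the distance at which the single term of w already equals Φ 0. The minimum
  -- with h w keeps the origin in T.
  set b : S n → ℝ := fun w => min (h w) ((Φ 0 / α w) ^ p⁻¹) with hb
  have hbpos : ∀ w ∈ U, 0 < b w := fun w hw =>
    lt_min (hh w hw) (Real.rpow_pos_of_pos (div_pos hM (hα w hw)) _)
  set T : Set (E n) := {ζ | ∀ w ∈ U, b w ≤ h w - inner ℝ ζ (w : E n)} with hT
  have hTsub : T ⊆ openPoly U h := fun ζ hζ w hw => by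
    have h1 := hζ w hw
    have h2 := hbpos w hw
    linarith
  have hTclosed : IsClosed T := by
    have : T = ⋂ w ∈ U, {ζ : E n | b w ≤ h w - inner ℝ ζ (w : E n)} := by
      ext ζ; simp [hT]
    rw [this]
    exact isClosed_biInter fun w _ => isClosed_le continuous_const (by fun_prop)
  have hTcomp : IsCompact T := Metric.isCompact_of_isClosed_isBounded hTclosed
    (isBounded_ball.subset (hTsub.trans (openPoly_subset_ball hε hU h)))
  have h0T : (0 : E n) ∈ T := fun w hw => by
    rw [inner_zero_left, sub_zero]; exact min_le_left _ _
  have hcont : ContinuousOn Φ T := by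
    refine continuousOn_finsetSum _ fun w hw => continuousOn_const.mul ?_
    refine ContinuousOn.rpow_const (by fun_prop) fun ζ hζ => Or.inl ?_
    exact (sub_pos.mpr (hTsub hζ w hw)).ne'
  obtain ⟨ξ, hξT, hξmin⟩ := hTcomp.exists_isMinOn ⟨0, h0T⟩ hcont
  refine ⟨ξ, hTsub hξT, fun ζ hζ => ?_⟩
  by_cases hζT : ζ ∈ T
  · exact hξmin hζT
  · have : ∃ w ∈ U, h w - inner ℝ ζ (w : E n) < b w := by
      by_contra hcon
      push Not at hcon
      exact hζT hcon
    obtain ⟨w, hw, hlt⟩ := this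
    have hpos : 0 < h w - inner ℝ ζ (w : E n) := sub_pos.mpr (hζ w hw)
    refine le_trans (hξmin h0T) ?_
    have hq : 0 < Φ 0 / α w := div_pos hM (hα w hw)
    have h1 : Φ 0 / α w ≤ (h w - inner ℝ ζ (w : E n)) ^ p := by
      have h2 := Real.rpow_le_rpow_of_nonpos hpos (hlt.le.trans (min_le_right _ _)) hp.le
      rwa [← Real.rpow_mul hq.le, inv_mul_cancel₀ hp.ne, Real.rpow_one] at h2
    have h3 : Φ 0 ≤ α w * (h w - inner ℝ ζ (w : E n)) ^ p := by
      rwa [div_le_iff₀' (hα w hw)] at h1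
    exact h3.trans (Finset.single_le_sum
      (f := fun w => α w * (h w - inner ℝ ζ (w : E n)) ^ p) (fun v hv =>
      mul_nonneg (hα v hv).le (Real.rpow_nonneg (sub_pos.mpr (hζ v hv)).le _)) hw)

/-- The derivative of the energy at ξ in a direction y is -p times the inner product of y with the
balance sum; it vanishes for all y, and p ≠ 0. -/
theorem isBalanced_of_minimizer (hp : p < 0) {h : S n → ℝ} {ξ : E n} (hξ : ξ ∈ openPoly U h)
    (hmin : ∀ ζ ∈ openPoly U h, energy U α p (fun v => h v - inner ℝ ξ (v : E n)) ≤
        energy U α p (fun v => h v - inner ℝ ζ (v : E n))) :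
    IsBalanced U α p fun v => h v - inner ℝ ξ (v : E n) := by
  refine ext_inner_left ℝ fun y => ?_
  have hderiv : HasDerivAt (fun t : ℝ => energy U α p (fun v => h v - inner ℝ (ξ + t • y) (v : E n)))
      (∑ v ∈ U, α v * (-inner ℝ y (v : E n) * p * (h v - inner ℝ ξ (v : E n)) ^ (p - 1))) 0 := by
    refine HasDerivAt.fun_sum fun v hv => HasDerivAt.const_mul _ ?_
    have h1 : HasDerivAt (fun t : ℝ => h v - inner ℝ (ξ + t • y) (v : E n))
        (-inner ℝ y (v : E n)) 0 := by
      have : (fun t : ℝ => h v - inner ℝ (ξ + t • y) (v : E n)) = fun t =>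
          h v - (inner ℝ ξ (v : E n) + t * inner ℝ y (v : E n)) := by
        funext t; rw [inner_add_left, inner_smul_left, conj_trivial]
      rw [this]
      have h2 := ((hasDerivAt_id (0 : ℝ)).mul_const (inner ℝ y (v : E n))).const_add
        (inner ℝ ξ (v : E n))
      simpa using h2.const_sub (h v)
    have h3 := h1.rpow_const (p := p) (Or.inl (by simpa using (sub_pos.mpr (hξ v hv)).ne'))
    simpa using h3
  have hc : Continuous fun t : ℝ => ξ + t • y := by fun_prop
  have hloc : IsLocalMin (fun t : ℝ => energy U α p (fun v => h v - inner ℝ (ξ + t • y) (v : E n)))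
      0 := by
    have hev : ∀ᶠ t in nhds (0 : ℝ), ξ + t • y ∈ openPoly U h :=
      hc.continuousAt.eventually ((isOpen_openPoly U h).mem_nhds (by simpa using hξ))
    filter_upwards [hev] with t ht
    simpa using hmin _ ht
  have hzero := hloc.hasDerivAt_eq_zero hderiv
  have hfac : ∑ v ∈ U, α v * (-inner ℝ y (v : E n) * p * (h v - inner ℝ ξ (v : E n)) ^ (p - 1)) =
      -p * ∑ v ∈ U, α v * (h v - inner ℝ ξ (v : E n)) ^ (p - 1) * inner ℝ y (v : E n) := by
    rw [Finset.mul_sum]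
    exact Finset.sum_congr rfl fun v _ => by ring
  rw [hfac, mul_eq_zero] at hzero
  have h4 := hzero.resolve_left (by linarith)
  rw [inner_sum, inner_zero_right, ← h4]
  exact Finset.sum_congr rfl fun v _ => by rw [inner_smul_right]

/-- Every polytope with normals `U` can be translated and dilated to one whose support numbers lie
in a fixed compact set. -/
theorem InGeneralPosition.exists_normalized (hn : 1 ≤ n) (hU : InGeneralPosition U) (hp : p < 0)
    (hα : ∀ v ∈ U, 0 < α v) (q : ℝ) :
    ∃ C : ℝ, ∀ h : S n → ℝ, (∀ v ∈ U, 0 < h v) → ∃ (g : S n → ℝ) (c : ℝ) (ξ : E n), 0 < c ∧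
      (∀ w ∈ U, 1 ≤ g w ∧ g w ≤ C) ∧ (∀ w ∉ U, g w = 1) ∧ IsBalanced U α p g ∧
      chordIntegral U q g = ENNReal.ofReal (c ^ ((n : ℝ) + q - 1)) * chordIntegral U q h ∧
      (∀ w ∈ U, 0 < h w - inner ℝ ξ (w : E n)) ∧
      c ^ p * energy U α p (fun w => h w - inner ℝ ξ (w : E n)) ≤ energy U α p g := by
  obtain ⟨C, hC⟩ := hU.exists_norm_le hn hp hα
  have hne := hU.nonempty hn
  obtain ⟨ε, hε, hεU⟩ := hU.exists_le_inner hn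
  refine ⟨C, fun h hh => ?_⟩
  obtain ⟨h₁, hh₁, heq, htight⟩ := exists_tight hh
  obtain ⟨ξ, hξ, hmin⟩ := exists_translation_minimizer hε hεU hne hp hα fun w hw => (hh₁ w hw).1
  have hbal := isBalanced_of_minimizer hp hξ hmin
  set g₀ : S n → ℝ := fun v => h₁ v - inner ℝ ξ (v : E n) with hg₀
  have hg₀pos : ∀ w ∈ U, 0 < g₀ w := fun w hw => sub_pos.mpr (hξ w hw)
  -- The previous bound concerns points of the polytope. Tightness of h₁ transfers it to the support
  -- numbers, which could otherwise be arbitrarily large at redundant constraints.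
  have hle : ∀ w ∈ U, ∀ w' ∈ U, g₀ w' ≤ C * g₀ w := by
    intro w hw w' hw'
    have h1 : h₁ w' ≤ C * g₀ w + inner ℝ ξ (w' : E n) := by
      refine htight w' hw' _ fun z hz => ?_
      have hmem : z - ξ ∈ openPoly U g₀ := fun v hv => by
        rw [inner_sub_left]
        exact sub_lt_sub_right (hz v hv) _
      have h2 := hC g₀ hg₀pos hbal _ hmem w hw
      have h3 := (le_abs_self _).trans (abs_inner_sphere_le (z - ξ) w')
      rw [inner_sub_left] at h3
      linarith
    simp only [hg₀]
    linarith
  obtain ⟨w₀, hw₀, hw₀min⟩ := U.exists_min_image g₀ hne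
  have hpos₀ := hg₀pos w₀ hw₀
  -- Dilate so that the smallest support number is 1; all others are then at most C. Off U the value
  -- is set to 1, so that g lies in a compact product.
  set c := (g₀ w₀)⁻¹ with hc
  have hcpos : 0 < c := inv_pos.mpr hpos₀
  set g : S n → ℝ := fun w => if w ∈ U then c * g₀ w else 1 with hg
  have hgU : ∀ w ∈ U, g w = c * g₀ w := fun w hw => by simp [hg, hw]
  refine ⟨g, c, ξ, hcpos, fun w hw => ?_, fun w hw => by simp [hg, hw], ?_, ?_, fun w hw => ?_, ?_⟩
  · rw [hgU w hw]
    constructor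
    · rw [hc, ← div_eq_inv_mul, one_le_div hpos₀]
      exact hw₀min w hw
    · rw [hc, ← div_eq_inv_mul, div_le_iff₀ hpos₀]
      exact hle w₀ hw₀ w hw
  · have h1 := hbal.const_mul hg₀pos hcpos
    rw [IsBalanced] at h1 ⊢
    exact (Finset.sum_congr rfl fun v hv => by rw [hgU v hv]).trans h1
  · rw [chordIntegral_congr hgU, chordIntegral_const_mul U q g₀ hcpos]
    congr 1
    have h1 : g₀ = fun w => h₁ w + inner ℝ (-ξ) (w : E n) := by
      funext w; rw [inner_neg_left, ← sub_eq_add_neg]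
    rw [h1, chordIntegral_add_inner, chordIntegral_eq_of_openPoly_eq heq]
  · have h1 := (hh₁ w hw).2
    have h2 := hg₀pos w hw
    simp only [hg₀] at h2
    linarith
  · have h1 : energy U α p g = c ^ p * energy U α p g₀ := by
      rw [← energy_const_mul hg₀pos hcpos]
      exact Finset.sum_congr rfl fun v hv => by rw [hgU v hv]
    rw [h1]
    refine mul_le_mul_of_nonneg_left (Finset.sum_le_sum fun v hv => ?_) (Real.rpow_nonneg hcpos.le _)
    refine mul_le_mul_of_nonneg_left ?_ (hα v hv).le
    -- Tightening lowers support numbers, so with p < 0 it can only raise the energy.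
    refine Real.rpow_le_rpow_of_nonpos (hg₀pos v hv) ?_ hp.le
    exact sub_le_sub_right (hh₁ v hv).2 _

end Normalization

/-! ### Existence of a maximizer and the Euler–Lagrange equations -/

section Variational

open scoped Classical

variable {n : ℕ} {U : Finset (S n)} {α : S n → ℝ} {p q : ℝ}

/-- The scale-invariant functional of the variational problem. -/
def objective (U : Finset (S n)) (p q e : ℝ) (h : S n → ℝ) : ℝ :=
  e ^ (((n : ℝ) + q - 1) / (-p)) * (chordIntegral U q h).toReal

/-- `g` maximizes, over all support numbers `h`, the minimum of the objective over the translates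
of `h`. -/
def IsMaximizer (U : Finset (S n)) (α : S n → ℝ) (p q : ℝ) (g : S n → ℝ) : Prop :=
  (∀ w ∈ U, 0 < g w) ∧ IsBalanced U α p g ∧ ∀ h : S n → ℝ, (∀ w ∈ U, 0 < h w) →
    ∃ ξ : E n, (∀ w ∈ U, 0 < h w - inner ℝ ξ (w : E n)) ∧
      objective U p q (energy U α p fun w => h w - inner ℝ ξ (w : E n)) h ≤
        objective U p q (energy U α p g) g

/-- The exponent (n + q - 1) / (-p) is the one for which the factor c^p of the energy cancels the
factor c^{n+q-1} of the chord integral. -/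
theorem objective_const_mul (hp : p < 0) (h : S n → ℝ) {e c : ℝ} (he : 0 ≤ e) (hc : 0 < c) :
    objective U p q (c ^ p * e) (fun w => c * h w) = objective U p q e h := by
  unfold objective
  rw [chordIntegral_const_mul U q h hc, ENNReal.toReal_mul,
    ENNReal.toReal_ofReal (Real.rpow_nonneg hc.le _), Real.mul_rpow (Real.rpow_nonneg hc.le _) he,
    ← Real.rpow_mul hc.le]
  have h1 : p * (((n : ℝ) + q - 1) / (-p)) = -((n : ℝ) + q - 1) := by
    have hp0 := hp.ne
    field_simp
  have h2 : c ^ (-((n : ℝ) + q - 1)) * c ^ ((n : ℝ) + q - 1) = 1 := by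
    rw [← Real.rpow_add hc, neg_add_cancel, Real.rpow_zero]
  rw [h1]
  linear_combination (e ^ (((n : ℝ) + q - 1) / (-p)) * (chordIntegral U q h).toReal) * h2

theorem objective_mono (hn : 1 ≤ n) (hp : p < 0) (hq : 0 < q) {e e' : ℝ} (he : 0 ≤ e)
    (hle : e ≤ e') (h : S n → ℝ) : objective U p q e h ≤ objective U p q e' h := by
  have hn' : (1 : ℝ) ≤ n := by exact_mod_cast hn
  refine mul_le_mul_of_nonneg_right (Real.rpow_le_rpow he hle ?_) ENNReal.toReal_nonneg
  exact div_nonneg (by linarith) (by linarith)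

theorem IsMaximizer.const_mul (hne : U.Nonempty) (hα : ∀ v ∈ U, 0 < α v) (hp : p < 0)
    {g : S n → ℝ} (hg : IsMaximizer U α p q g) {c : ℝ} (hc : 0 < c) :
    IsMaximizer U α p q fun w => c * g w := by
  obtain ⟨hpos, hbal, hmax⟩ := hg
  refine ⟨fun w hw => mul_pos hc (hpos w hw), hbal.const_mul hpos hc, fun h hh => ?_⟩
  rw [energy_const_mul hpos hc, objective_const_mul hp g (energy_pos hne hα hpos).le hc]
  exact hmax h hh

/-- The objective is continuous on the compact set of balanced normalized support numbers. Any
competitor h has a translate whose objective is at most that of its normalization, so the maximum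
over this set dominates all h. -/
theorem InGeneralPosition.exists_isMaximizer (hn : 1 ≤ n) (hU : InGeneralPosition U) (hp : p < 0)
    (hq : 0 < q) (hα : ∀ v ∈ U, 0 < α v) : ∃ g, IsMaximizer U α p q g := by
  have hne := hU.nonempty hn
  obtain ⟨ε, hε, hεU⟩ := hU.exists_le_inner hn
  obtain ⟨C, hC⟩ := hU.exists_normalized hn hp hα q
  set K : Set (S n → ℝ) := (Set.univ.pi fun _ => Set.Icc 1 (max C 1)) ∩ {g | IsBalanced U α p g}
    with hK
  have hKpos : ∀ g ∈ K, ∀ w, 0 < g w := fun g hg w =>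
    zero_lt_one.trans_le (hg.1 w (Set.mem_univ w)).1
  have hcont_bal : ContinuousOn (fun g : S n → ℝ => ∑ v ∈ U, (α v * g v ^ (p - 1)) • (v : E n))
      (Set.univ.pi fun _ => Set.Icc 1 (max C 1)) := by
    refine continuousOn_finsetSum _ fun v _ => ?_
    have hv : ContinuousOn (fun g : S n → ℝ => g v ^ (p - 1))
        (Set.univ.pi fun _ => Set.Icc 1 (max C 1)) :=
      (continuous_apply v).continuousOn.rpow_const fun g hg =>
        Or.inl (zero_lt_one.trans_le (hg v (Set.mem_univ v)).1).ne'
    fun_prop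
  have hKc : IsCompact K := by
    have hc : IsCompact (Set.univ.pi fun _ : S n => Set.Icc (1 : ℝ) (max C 1)) :=
      isCompact_univ_pi fun _ => isCompact_Icc
    exact hc.of_isClosed_subset (hcont_bal.preimage_isClosed_of_isClosed hc.isClosed
      isClosed_singleton) Set.inter_subset_left
  have hmem : ∀ g : S n → ℝ, (∀ w ∈ U, 1 ≤ g w ∧ g w ≤ C) → (∀ w ∉ U, g w = 1) →
      IsBalanced U α p g → g ∈ K := by
    refine fun g h1 h2 h3 => ⟨fun w _ => ?_, h3⟩
    by_cases hw : w ∈ U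
    · exact ⟨(h1 w hw).1, (h1 w hw).2.trans (le_max_left _ _)⟩
    · rw [h2 w hw]; exact ⟨le_rfl, le_max_right _ _⟩
  have hKne : K.Nonempty := by
    obtain ⟨g, c, ξ, -, h1, h2, h3, -⟩ := hC (fun _ => 1) fun _ _ => one_pos
    exact ⟨g, hmem g h1 h2 h3⟩
  have hcont : ContinuousOn (fun g => objective U p q (energy U α p g) g) K := by
    refine ContinuousOn.mul ?_ ?_
    · refine ContinuousOn.rpow_const ?_ fun g hg =>
        Or.inl (energy_pos hne hα fun w _ => hKpos g hg w).ne'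
      refine continuousOn_finsetSum _ fun v _ => continuousOn_const.mul ?_
      exact (continuous_apply v).continuousOn.rpow_const fun g hg => Or.inl (hKpos g hg v).ne'
    · intro g hg
      refine ContinuousAt.continuousWithinAt ?_
      exact (ENNReal.continuousAt_toReal (chordIntegral_lt_top hε hεU hq g).ne).comp
        (continuousAt_chordIntegral hε hεU hq fun w _ => hKpos g hg w)
  obtain ⟨g, hgK, hgmax⟩ := hKc.exists_isMaxOn hKne hcont
  refine ⟨g, fun w _ => hKpos g hgK w, hgK.2, fun h hh => ?_⟩
  obtain ⟨g', c, ξ, hc, h1, h2, h3, h4, h5, h6⟩ := hC h hh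
  refine ⟨ξ, h5, ?_⟩
  have he := (energy_pos (p := p) hne hα h5).le
  rw [← objective_const_mul hp h he hc]
  refine le_trans ?_ (hgmax (hmem g' h1 h2 h3))
  refine le_trans (objective_mono hn hp hq (mul_nonneg (Real.rpow_nonneg hc.le _) he) h6 _) ?_
  refine le_of_eq ?_
  simp only [objective]
  rw [chordIntegral_const_mul U q h hc, h4]

/-- The Euler–Lagrange equations. -/
theorem IsMaximizer.sliceIntegral_eq (hn : 1 ≤ n) (hU : InGeneralPosition U) (hp : p < 0)
    (hq : 0 < q) (hα : ∀ v ∈ U, 0 < α v) {g : S n → ℝ} (hg : IsMaximizer U α p q g) {v : S n}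
    (hv : v ∈ U) :
    2 * (sliceIntegral (U.erase v) v q g (g v)).toReal =
      ((n : ℝ) + q - 1) * (chordIntegral U q g).toReal / energy U α p g *
        (α v * g v ^ (p - 1)) := by
  have hne := hU.nonempty hn
  obtain ⟨ε, hε, hεU⟩ := hU.exists_le_inner hn
  obtain ⟨hpos, hbal, hmax⟩ := hg
  set f := energy U α p g with hf
  have hfpos : 0 < f := energy_pos hne hα hpos
  set s := ((n : ℝ) + q - 1) / (-p) with hs
  set d := α v * p * g v ^ (p - 1) with hd
  have hG := hasDerivAt_chordIntegral hε hεU hq hpos hv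
  -- The tangent line of the energy when only g v moves. It bounds from below the energy of every
  -- admissible translate of the perturbed numbers, so the objective built from it is still at most
  -- the maximum, with equality at t = g v.
  have hlin : HasDerivAt (fun t : ℝ => f + d * (t - g v)) d (g v) := by
    have := (((hasDerivAt_id (g v)).sub_const (g v)).const_mul d).const_add f
    simpa using this
  have hpow := hlin.rpow_const (p := s) (Or.inl (by simpa using hfpos.ne'))
  have hprod := hpow.mul hG
  have hcont : ContinuousAt (fun t : ℝ => f + d * (t - g v)) (g v) := hlin.continuousAt
  have hloc : IsLocalMax ((fun t : ℝ => (f + d * (t - g v)) ^ s) *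
      fun t => (chordIntegral U q (Function.update g v t)).toReal) (g v) := by
    have hev1 : ∀ᶠ t in nhds (g v), 0 < f + d * (t - g v) :=
      hcont.eventually (lt_mem_nhds (by simpa using hfpos))
    have hev2 : ∀ᶠ t in nhds (g v), 0 < t := lt_mem_nhds (hpos v hv)
    filter_upwards [hev1, hev2] with t ht1 ht2
    have hup : ∀ w ∈ U, 0 < Function.update g v t w := by
      intro w hw
      rcases eq_or_ne w v with rfl | hwv
      · rwa [Function.update_self]
      · rw [Function.update_of_ne hwv]; exact hpos w hw
    obtain ⟨ξ, hξ, hle⟩ := hmax _ hup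
    have htan := hbal.energy_tangent_le hp hα hpos hξ
    have hsum : ∑ w ∈ U, α w * p * g w ^ (p - 1) * (Function.update g v t w - g w) =
        d * (t - g v) := by
      rw [Finset.sum_eq_single_of_mem v hv fun w _ hwv => by
        rw [Function.update_of_ne hwv, sub_self, mul_zero], Function.update_self]
    rw [hsum] at htan
    have h1 := (objective_mono (U := U) hn hp hq ht1.le htan
      (Function.update g v t)).trans hle
    simp only [Pi.mul_apply, sub_self, mul_zero, add_zero, Function.update_eq_self]
    exact h1
  have hzero := hloc.hasDerivAt_eq_zero hprod
  simp only [sub_self, mul_zero, add_zero, Function.update_eq_self] at hzero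
  rw [Real.rpow_sub_one hfpos.ne'] at hzero
  have hfs : f ^ s ≠ 0 := (Real.rpow_pos_of_pos hfpos s).ne'
  have hsp : s * p = -((n : ℝ) + q - 1) := by
    have hp0 := hp.ne
    rw [hs]; field_simp
  have h2 : d * s / f * (chordIntegral U q g).toReal +
      2 * (sliceIntegral (U.erase v) v q g (g v)).toReal = 0 := by
    refine mul_left_cancel₀ hfs ?_
    rw [mul_zero, ← hzero]
    ring
  have h3 : d * s = -((n : ℝ) + q - 1) * (α v * g v ^ (p - 1)) := by
    rw [← hsp, hd]; ring
  rw [h3] at h2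
  linear_combination h2

theorem InGeneralPosition.sliceIntegral_ne_top (hn : 1 ≤ n) (hU : InGeneralPosition U) (hq : 0 < q)
    {g : S n → ℝ} (hg : ∀ w ∈ U, 0 < g w) {v : S n} (hv : v ∈ U) :
    sliceIntegral (U.erase v) v q g (g v) ≠ ⊤ := by
  obtain ⟨ε, hε, hεU⟩ := hU.exists_le_inner hn
  obtain ⟨C, hC, hle⟩ := exists_sliceIntegral_le hε hεU hq hg v (g v + 1)
  exact ne_top_of_le_ne_top hC (hle _ (hg v hv) (by linarith))

/-- The discrete `L_p` chord Minkowski problem, in terms of support numbers. -/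
theorem InGeneralPosition.exists_sliceIntegral_eq (hn : 1 ≤ n) (hU : InGeneralPosition U)
    (hp : p < 0) (hq : 0 < q) (hα : ∀ v ∈ U, 0 < α v) {C : ℝ≥0∞} (hC0 : C ≠ 0) (hC : C ≠ ⊤) :
    ∃ g : S n → ℝ, (∀ w ∈ U, 0 < g w) ∧ ∀ v ∈ U,
      C * (ENNReal.ofReal (g v ^ (1 - p)) * sliceIntegral (U.erase v) v q g (g v)) =
        ENNReal.ofReal (α v) := by
  have hne := hU.nonempty hn
  obtain ⟨ε, hε, hεU⟩ := hU.exists_le_inner hn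
  obtain ⟨g₀, hg₀⟩ := hU.exists_isMaximizer hn hp hq hα
  have hn' : (1 : ℝ) ≤ n := by exact_mod_cast hn
  set m := (n : ℝ) + q - 1 with hm
  have hmpos : 0 < m := by rw [hm]; linarith
  have hpos₀ := hg₀.1
  have hGpos : 0 < (chordIntegral U q g₀).toReal :=
    ENNReal.toReal_pos (chordIntegral_pos hn hε hεU hpos₀).ne' (chordIntegral_lt_top hε hεU hq g₀).ne
  have hfpos : 0 < energy U α p g₀ := energy_pos hne hα hpos₀
  have hCpos : 0 < C.toReal := ENNReal.toReal_pos hC0 hC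
  -- After dilation by c the Euler–Lagrange factor is multiplied by c^m / c^p, so the equation
  -- sought reads c^{m-p} κ = 1. It is solvable because m - p > 0.
  set κ := C.toReal * (m * (chordIntegral U q g₀).toReal / energy U α p g₀) / 2 with hκ
  have hκpos : 0 < κ := by positivity
  set c := κ ^ (-(m - p)⁻¹) with hc
  have hcpos : 0 < c := Real.rpow_pos_of_pos hκpos _
  have hcκ : c ^ (m - p) * κ = 1 := by
    rw [hc, ← Real.rpow_mul hκpos.le, neg_mul, inv_mul_cancel₀ (by linarith), Real.rpow_neg_one,
      inv_mul_cancel₀ hκpos.ne']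
  have hg := hg₀.const_mul hne hα hp hcpos
  refine ⟨fun w => c * g₀ w, hg.1, fun v hv => ?_⟩
  have heq := hg.sliceIntegral_eq hn hU hp hq hα hv
  have hfin := hU.sliceIntegral_ne_top hn hq hg.1 hv
  rw [energy_const_mul hpos₀ hcpos, chordIntegral_const_mul U q g₀ hcpos, ENNReal.toReal_mul,
    ENNReal.toReal_ofReal (Real.rpow_nonneg hcpos.le _)] at heq
  set k := sliceIntegral (U.erase v) v q (fun w => c * g₀ w) (c * g₀ v) with hk
  have hgv : 0 < c * g₀ v := hg.1 v hv
  rw [← ENNReal.ofReal_toReal hC, ← ENNReal.ofReal_toReal hfin,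
    ← ENNReal.ofReal_mul (Real.rpow_nonneg hgv.le _), ← ENNReal.ofReal_mul hCpos.le]
  congr 1
  have h1 : (c * g₀ v) ^ (1 - p) * (c * g₀ v) ^ (p - 1) = 1 := by
    rw [← Real.rpow_add hgv]; simp
  have h2 : c ^ (m - p) = c ^ m / c ^ p := Real.rpow_sub hcpos _ _
  have hcp : c ^ p ≠ 0 := (Real.rpow_pos_of_pos hcpos p).ne'
  calc C.toReal * ((c * g₀ v) ^ (1 - p) * k.toReal)
      = C.toReal * ((c * g₀ v) ^ (1 - p) * (2 * k.toReal)) / 2 := by ring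
    _ = (c ^ (m - p) * κ) * ((c * g₀ v) ^ (1 - p) * (c * g₀ v) ^ (p - 1)) * α v := by
      rw [heq, ← hm, h2, hκ]
      field_simp
    _ = α v := by rw [hcκ, h1]; ring

end Variational

/-! ### From support numbers to polytopes: facets, Gauss map, chord measure -/

section Geometry

open scoped Classical

variable {n : ℕ} {U : Finset (S n)} {g : S n → ℝ}

/-- The polyhedron `{x : x ⬝ w ≤ g w for all w ∈ U}`. -/
def closedPoly (U : Finset (S n)) (g : S n → ℝ) : Set (E n) :=
  {x | ∀ w ∈ U, inner ℝ x (w : E n) ≤ g w}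

/-- The points at which `v` is the only active constraint. -/
def openFacet (U : Finset (S n)) (g : S n → ℝ) (v : S n) : Set (E n) :=
  {z | inner ℝ z (v : E n) = g v ∧ z ∈ openPoly (U.erase v) g}

theorem mem_closedPoly {x : E n} :
    x ∈ closedPoly U g ↔ ∀ w ∈ U, inner ℝ x (w : E n) ≤ g w := Iff.rfl

theorem closedPoly_eq_biInter (U : Finset (S n)) (g : S n → ℝ) :
    closedPoly U g = ⋂ w ∈ U, {x : E n | inner ℝ x (w : E n) ≤ g w} := by
  ext x; simp [mem_closedPoly]

theorem isClosed_closedPoly (U : Finset (S n)) (g : S n → ℝ) : IsClosed (closedPoly U g) := by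
  rw [closedPoly_eq_biInter]
  exact isClosed_biInter fun w _ => isClosed_le (by fun_prop) continuous_const

theorem convex_closedPoly (U : Finset (S n)) (g : S n → ℝ) : Convex ℝ (closedPoly U g) := by
  intro x hx y hy a b ha hb hab w hw
  rw [inner_add_left, inner_smul_left, inner_smul_left, conj_trivial, conj_trivial]
  calc a * inner ℝ x (w : E n) + b * inner ℝ y (w : E n) ≤ a * g w + b * g w :=
        add_le_add (mul_le_mul_of_nonneg_left (hx w hw) ha)
          (mul_le_mul_of_nonneg_left (hy w hw) hb)
    _ = g w := by rw [← add_mul, hab, one_mul]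

theorem openPoly_subset_interior (U : Finset (S n)) (g : S n → ℝ) :
    openPoly U g ⊆ interior (closedPoly U g) :=
  interior_maximal (fun _ hx w hw => (hx w hw).le) (isOpen_openPoly U g)

theorem InGeneralPosition.isCompact_closedPoly (hn : 1 ≤ n) (hU : InGeneralPosition U)
    (g : S n → ℝ) : IsCompact (closedPoly U g) := by
  obtain ⟨ε, hε, hεU⟩ := hU.exists_le_inner hn
  refine Metric.isCompact_of_isClosed_isBounded (isClosed_closedPoly U g) ?_
  refine isBounded_ball.subset (Set.Subset.trans ?_
    (openPoly_subset_ball hε hεU fun w => g w + 1))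
  exact fun x hx w hw => (hx w hw).trans_lt (lt_add_one _)

theorem zero_mem_openPoly (hg : ∀ w ∈ U, 0 < g w) : (0 : E n) ∈ openPoly U g := fun w hw => by
  simpa using hg w hw

/-- A polyhedron has finitely many extreme points: they are determined by their active
constraints. -/
theorem finite_extremePoints_closedPoly (U : Finset (S n)) (g : S n → ℝ) :
    ((closedPoly U g).extremePoints ℝ).Finite := by
  set A : E n → Finset (S n) := fun x => U.filter fun w => inner ℝ x (w : E n) = g w with hA
  refine Set.Finite.of_injOn (f := A) (t := (U.powerset : Set (Finset (S n))))
    (fun x _ => Finset.mem_coe.mpr (Finset.mem_powerset.mpr (Finset.filter_subset _ _))) ?_ (Finset.finite_toSet _)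
  intro x hx y hy hxy
  obtain ⟨hxP, hxe⟩ := mem_extremePoints_iff_left.mp hx
  have hyP := (mem_extremePoints_iff_left.mp hy).1
  -- If x and y have the same active constraints, x can be pushed slightly away from y without
  -- leaving the polyhedron: active constraints are constant along the line and the others have
  -- slack. Then x is interior to a segment ending at y, so x = y by extremality.
  have hev : ∀ᶠ t in nhdsWithin (0 : ℝ) (Set.Ioi 0), ∀ w ∈ U,
      inner ℝ (x + t • (x - y)) (w : E n) ≤ g w := by
    rw [Filter.eventually_all_finset]
    intro w hw
    by_cases hact : inner ℝ x (w : E n) = g w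
    · have hmem : w ∈ A y := hxy ▸ Finset.mem_filter.mpr ⟨hw, hact⟩
      have hy2 := (Finset.mem_filter.mp hmem).2
      refine Filter.Eventually.of_forall fun t => ?_
      rw [inner_add_left, inner_smul_left, inner_sub_left, hact, hy2]
      simp
    · have hlt : inner ℝ x (w : E n) < g w := lt_of_le_of_ne (hxP w hw) hact
      have hc : Continuous fun t : ℝ => inner ℝ (x + t • (x - y)) (w : E n) := by fun_prop
      refine nhdsWithin_le_nhds ((hc.continuousAt.eventually
        (gt_mem_nhds (by simpa using hlt))).mono fun t ht => ht.le)
  obtain ⟨t, ht, ht0⟩ := (hev.and self_mem_nhdsWithin).exists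
  have ht0' : 0 < t := ht0
  have hseg : x ∈ openSegment ℝ (x + t • (x - y)) y := by
    refine ⟨1 / (1 + t), t / (1 + t), by positivity, by positivity, by field_simp, ?_⟩
    rw [smul_add, smul_smul, smul_sub]
    have h1 : (1 / (1 + t)) • x + (1 / (1 + t) * t) • x = x := by
      rw [← add_smul]
      convert one_smul ℝ x
      field_simp
    have h2 : (1 / (1 + t) * t) = t / (1 + t) := by ring
    rw [h2] at h1 ⊢
    calc _ = (1 / (1 + t)) • x + (t / (1 + t)) • x := by abel
      _ = x := h1
  have h3 := hxe _ ht _ hyP hseg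
  have h4 : t • (x - y) = 0 := by simpa using h3
  exact sub_eq_zero.mp ((smul_eq_zero.mp h4).resolve_left ht0'.ne')

theorem InGeneralPosition.isPolytope_closedPoly (hn : 1 ≤ n) (hU : InGeneralPosition U)
    (g : S n → ℝ) : IsPolytope (closedPoly U g) := by
  have hfin := finite_extremePoints_closedPoly U g
  refine ⟨hfin.toFinset, ?_⟩
  rw [hfin.coe_toFinset]
  conv_lhs => rw [← closure_convexHull_extremePoints (hU.isCompact_closedPoly hn g)
    (convex_closedPoly U g)]
  exact (hfin.isClosed_convexHull ℝ).closure_eq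

theorem supportFun_eq_of_forall_le {K : Set (E n)} {z v : E n} (hz : z ∈ K)
    (hle : ∀ x ∈ K, inner ℝ x v ≤ inner ℝ z v) : supportFun K v = inner ℝ z v :=
  IsGreatest.csSup_eq ⟨⟨z, hz, rfl⟩, by rintro _ ⟨x, hx, rfl⟩; exact hle x hx⟩

theorem inner_le_supportFun {K : Set (E n)} (hK : IsCompact K) {x : E n} (hx : x ∈ K) (v : E n) :
    inner ℝ x v ≤ supportFun K v :=
  le_csSup (hK.image (by fun_prop)).bddAbove ⟨x, hx, rfl⟩

theorem supportFun_closedPoly_le (hg : ∀ w ∈ U, 0 < g w) {w : S n} (hw : w ∈ U) :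
    supportFun (closedPoly U g) w ≤ g w := by
  have h0 := interior_subset (openPoly_subset_interior U g (zero_mem_openPoly hg))
  exact csSup_le ⟨_, 0, h0, rfl⟩ (by rintro _ ⟨x, hx, rfl⟩; exact hx w hw)

theorem supportFun_closedPoly_eq {z : E n} (hz : z ∈ closedPoly U g) {w : S n} (hw : w ∈ U)
    (hzw : inner ℝ z (w : E n) = g w) : supportFun (closedPoly U g) w = g w := by
  rw [← hzw]
  exact supportFun_eq_of_forall_le hz fun x hx => hzw ▸ hx w hw

theorem InGeneralPosition.closedPoly_mem_polytopeClass (hn : 1 ≤ n) (hU : InGeneralPosition U)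
    (hg : ∀ w ∈ U, 0 < g w) : closedPoly U g ∈ polytopeClass U := by
  refine ⟨hU.isPolytope_closedPoly hn g, Set.Subset.antisymm (fun x hx => ?_) fun x hx => ?_⟩
  · exact Set.mem_iInter₂.mpr fun w _ => inner_le_supportFun (hU.isCompact_closedPoly hn g) hx w
  · exact fun w hw => le_trans (Set.mem_iInter₂.mp hx w hw) (supportFun_closedPoly_le hg hw)

theorem exists_active_of_not_mem_interior {x : E n} (hx : x ∈ closedPoly U g)
    (hxi : x ∉ interior (closedPoly U g)) : ∃ w ∈ U, inner ℝ x (w : E n) = g w := by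
  by_contra hcon
  push Not at hcon
  exact hxi (openPoly_subset_interior U g fun w hw => lt_of_le_of_ne (hx w hw) (hcon w hw))

theorem not_mem_interior_of_supportFun_eq {K : Set (E n)} (hK : IsCompact K) {z : E n} {v : S n}
    (hz : inner ℝ z (v : E n) = supportFun K v) : z ∉ interior K := by
  intro hzi
  have hc : Continuous fun t : ℝ => z + t • (v : E n) := by fun_prop
  have hev : ∀ᶠ t in nhdsWithin (0 : ℝ) (Set.Ioi 0), z + t • (v : E n) ∈ interior K :=
    nhdsWithin_le_nhds (hc.continuousAt.eventually (isOpen_interior.mem_nhds (by simpa using hzi)))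
  obtain ⟨t, ht, ht0⟩ := (hev.and self_mem_nhdsWithin).exists
  have h1 := inner_le_supportFun hK (interior_subset ht) (v : E n)
  rw [inner_add_left, inner_smul_left, inner_sphere_self, hz] at h1
  simp only [conj_trivial, mul_one] at h1
  have : (0 : ℝ) < t := ht0
  linarith

/-- A single constraint w is active on the whole facet, and the facet spans a space of dimension n -
1, so v and w are both orthogonal to it and v = ±w. -/
theorem InGeneralPosition.mem_of_isFacetNormal (hn : 1 ≤ n) (hU : InGeneralPosition U)
    (hg : ∀ w ∈ U, 0 < g w) {v : S n} (hv : IsFacetNormal (closedPoly U g) v) : v ∈ U := by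
  set P := closedPoly U g with hP
  have hPc : IsCompact P := hU.isCompact_closedPoly hn g
  set F := P ∩ supportHyperplane P v with hF
  obtain ⟨hFne, hrank⟩ := hv
  have hFconv : Convex ℝ F := by
    refine (convex_closedPoly U g).inter ?_
    intro x hx y hy a b _ _ hab
    have hx' : inner ℝ x (v : E n) = supportFun P v := hx
    have hy' : inner ℝ y (v : E n) = supportFun P v := hy
    change inner ℝ (a • x + b • y) (v : E n) = supportFun P v
    rw [inner_add_left, inner_smul_left, inner_smul_left, hx', hy', conj_trivial, conj_trivial,
      ← add_mul, hab, one_mul]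
  -- Otherwise each w is slack at some point of F; the average of these points is in F and slack for
  -- all w, hence interior, which is impossible on a support hyperplane.
  have hw : ∃ w ∈ U, ∀ x ∈ F, inner ℝ x (w : E n) = g w := by
    by_contra hcon
    push Not at hcon
    choose! x hxF hxne using hcon
    have hUne := hU.nonempty hn
    have hcard : (0 : ℝ) < U.card := by exact_mod_cast hUne.card_pos
    set z := ∑ w ∈ U, (U.card : ℝ)⁻¹ • x w with hz
    have hzF : z ∈ F := hFconv.sum_mem (fun _ _ => by positivity)
      (by rw [Finset.sum_const, nsmul_eq_mul, mul_inv_cancel₀ hcard.ne']) hxF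
    refine not_mem_interior_of_supportFun_eq hPc hzF.2 (openPoly_subset_interior U g ?_)
    intro w hw
    rw [hz, sum_inner]
    have hlt : ∑ w' ∈ U, inner ℝ ((U.card : ℝ)⁻¹ • x w') (w : E n) <
        ∑ _w' ∈ U, (U.card : ℝ)⁻¹ * g w := by
      refine Finset.sum_lt_sum (fun w' hw' => ?_) ⟨w, hw, ?_⟩
      · rw [inner_smul_left, conj_trivial]
        exact mul_le_mul_of_nonneg_left ((hxF w' hw').1 w hw) (by positivity)
      · rw [inner_smul_left, conj_trivial]
        exact mul_lt_mul_of_pos_left (lt_of_le_of_ne ((hxF w hw).1 w hw) (hxne w hw))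
          (by positivity)
    rwa [Finset.sum_const, nsmul_eq_mul, mul_inv_cancel_left₀ hcard.ne'] at hlt
  obtain ⟨w, hwU, hwF⟩ := hw
  have hspanP : vectorSpan ℝ P = ⊤ := by
    have h1 : affineSpan ℝ P = ⊤ := top_unique <|
      (isOpen_interior.affineSpan_eq_top
        ⟨0, openPoly_subset_interior U g (zero_mem_openPoly hg)⟩) ▸
        affineSpan_mono ℝ interior_subset
    rw [← direction_affineSpan, h1, AffineSubspace.direction_top]
  rw [hspanP, finrank_top, finrank_euclideanSpace_fin, ← hF] at hrank
  have hperp : ∀ (u : S n) (c : ℝ), (∀ x ∈ F, inner ℝ x (u : E n) = c) →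
      vectorSpan ℝ F = (Submodule.span ℝ {(u : E n)})ᗮ := by
    intro u c hu
    refine Submodule.eq_of_le_of_finrank_eq ?_ ?_
    · rw [vectorSpan_def, Submodule.span_le]
      rintro _ ⟨x, hx, y, hy, rfl⟩
      refine (Submodule.mem_orthogonal_singleton_iff_inner_left).mpr ?_
      simp only [vsub_eq_sub]
      rw [inner_sub_left, hu x hx, hu y hy, sub_self]
    · have h1 := (Submodule.span ℝ {(u : E n)}).finrank_add_finrank_orthogonal
      rw [finrank_span_singleton (ne_zero_of_mem_unit_sphere u), finrank_euclideanSpace_fin] at h1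
      omega
  have h1 := hperp v _ fun x hx => hx.2
  have h2 := hperp w _ hwF
  have h3 : Submodule.span ℝ {(v : E n)} = Submodule.span ℝ {(w : E n)} := by
    rw [← Submodule.orthogonal_orthogonal (Submodule.span ℝ {(v : E n)}), ← h1, h2,
      Submodule.orthogonal_orthogonal]
  have h4 : (v : E n) ∈ Submodule.span ℝ {(w : E n)} := h3 ▸ Submodule.mem_span_singleton_self _
  obtain ⟨c, hc⟩ := Submodule.mem_span_singleton.mp h4
  have habs : |c| = 1 := by
    have := congrArg norm hc
    simpa [norm_smul] using this
  rcases (abs_eq zero_le_one).mp habs with rfl | rfl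
  · rw [one_smul] at hc
    exact (Subtype.ext hc : w = v) ▸ hwU
  -- The case v = -w: the support number in direction v would be -g w < 0, although the origin lies
  -- in the polytope.
  · exfalso
    obtain ⟨x, hx⟩ := hFne
    have h5 : inner ℝ x (v : E n) = supportFun P v := hx.2
    have h6 := inner_le_supportFun hPc
      (interior_subset (openPoly_subset_interior U g (zero_mem_openPoly hg))) (v : E n)
    rw [inner_zero_left, ← h5, ← hc, inner_smul_right, hwF x hx] at h6
    linarith [hg w hwU]

theorem openFacet_subset_closedPoly (U : Finset (S n)) (g : S n → ℝ) (v : S n) :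
    openFacet U g v ⊆ closedPoly U g := by
  rintro z ⟨hz1, hz2⟩ w hw
  rcases eq_or_ne w v with rfl | hwv
  · exact hz1.le
  · exact (hz2 w (Finset.mem_erase.mpr ⟨hwv, hw⟩)).le

theorem measurableSet_openFacet (U : Finset (S n)) (g : S n → ℝ) (v : S n) :
    MeasurableSet (openFacet U g v) :=
  (isClosed_eq (by fun_prop) continuous_const : IsClosed
    {z : E n | inner ℝ z (v : E n) = g v}).measurableSet.inter (measurableSet_openPoly _ _)

/-- Near z only the constraint v matters, so one can move slightly in every direction y with y ⬝ v ≤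
0, and a normal v' must satisfy y ⬝ v' ≤ 0 for all of these. -/
theorem InGeneralPosition.normals_eq_of_mem_openFacet (hn : 1 ≤ n) (hU : InGeneralPosition U)
    {v : S n} (hv : v ∈ U) {z : E n} (hz : z ∈ openFacet U g v) :
    normals (closedPoly U g) z = {v} := by
  have hzP := openFacet_subset_closedPoly U g v hz
  have hPc := hU.isCompact_closedPoly hn g
  refine Set.eq_singleton_iff_unique_mem.mpr ⟨?_, fun v' hv' => ?_⟩
  · exact hz.1.trans (supportFun_closedPoly_eq hzP hv hz.1).symm
  · have hv'' : inner ℝ z (v' : E n) = supportFun (closedPoly U g) v' := hv'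
    have hdir : ∀ y : E n, inner ℝ y (v : E n) ≤ 0 → inner ℝ y (v' : E n) ≤ 0 := by
      intro y hy
      obtain ⟨δ, hδ, hmem⟩ := exists_add_smul_mem_openPoly hz.2 y
      have hmemP : z + δ • y ∈ closedPoly U g := by
        intro w hw
        rcases eq_or_ne w v with rfl | hwv
        · rw [inner_add_left, inner_smul_left, conj_trivial, hz.1]
          nlinarith
        · exact (hmem w (Finset.mem_erase.mpr ⟨hwv, hw⟩)).le
      have h1 := inner_le_supportFun hPc hmemP (v' : E n)
      rw [← hv'', inner_add_left, inner_smul_left, conj_trivial] at h1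
      by_contra hpos
      push Not at hpos
      nlinarith [mul_pos hδ hpos]
    set c := inner ℝ (v : E n) (v' : E n) with hc
    -- Testing with v' - c v gives c² ≥ 1 and testing with -v gives c ≥ 0; with Cauchy–Schwarz, c =
    -- 1.
    have h1 := hdir ((v' : E n) - c • (v : E n)) (by
      rw [inner_sub_left, inner_smul_left, inner_sphere_self, real_inner_comm, conj_trivial, mul_one,
        ← hc, sub_self])
    rw [inner_sub_left, inner_smul_left, inner_sphere_self, conj_trivial, ← hc] at h1
    have h2 := hdir (-(v : E n)) (by rw [inner_neg_left, inner_sphere_self]; norm_num)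
    rw [inner_neg_left, ← hc] at h2
    have h3 : c ≤ 1 := by simpa using real_inner_le_norm (v : E n) (v' : E n)
    have h4 : c = 1 := by nlinarith
    have h5 := (inner_eq_one_iff_of_norm_eq_one (𝕜 := ℝ) (x := (v : E n)) (y := (v' : E n))
      (by simp) (by simp)).mp h4
    exact (Subtype.ext h5).symm

/-- A boundary point has an active constraint, and every active constraint is a normal. Uniqueness
of the normal therefore means that exactly one constraint is active. -/
theorem InGeneralPosition.gaussPreimage_closedPoly (hn : 1 ≤ n) (hU : InGeneralPosition U)
    (η : Set (S n)) :
    gaussPreimage (closedPoly U g) η = ⋃ v ∈ U.filter (· ∈ η), openFacet U g v := by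
  have hPc := hU.isCompact_closedPoly hn g
  ext z
  simp only [Set.mem_iUnion, Finset.mem_filter, exists_prop]
  constructor
  · rintro ⟨hzf, v, hvη, hnorm⟩
    have hzP : z ∈ closedPoly U g := (isClosed_closedPoly U g).frontier_subset hzf
    have hact : ∀ w ∈ U, inner ℝ z (w : E n) = g w → w = v := by
      intro w hw hzw
      have : w ∈ normals (closedPoly U g) z :=
        hzw.trans (supportFun_closedPoly_eq hzP hw hzw).symm
      rw [hnorm] at this
      exact this
    obtain ⟨w, hw, hzw⟩ := exists_active_of_not_mem_interior hzP hzf.2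
    obtain rfl := hact w hw hzw
    refine ⟨w, ⟨hw, hvη⟩, hzw, fun w' hw' => ?_⟩
    refine lt_of_le_of_ne (hzP w' (Finset.mem_of_mem_erase hw')) fun h => ?_
    exact Finset.ne_of_mem_erase hw' (hact w' (Finset.mem_of_mem_erase hw') h)
  · rintro ⟨v, ⟨hvU, hvη⟩, hz⟩
    have hnorm := hU.normals_eq_of_mem_openFacet hn hvU hz
    have hzP := openFacet_subset_closedPoly U g v hz
    refine ⟨⟨subset_closure hzP, ?_⟩, v, hvη, hnorm⟩
    refine not_mem_interior_of_supportFun_eq hPc (v := v) ?_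
    exact hz.1.trans (supportFun_closedPoly_eq hzP hvU hz.1).symm

theorem gaussMap_eq_of_normals_eq {K : Set (E n)} {z : E n} {v : S n} (h : normals K z = {v}) :
    gaussMap K z = v := by
  have hex : ∃ v : S n, normals K z = {v} := ⟨v, h⟩
  rw [gaussMap, dif_pos hex]
  rw [← Set.singleton_eq_singleton_iff.mp (h.symm.trans hex.choose_spec)]

theorem disjoint_openFacet {v w : S n} (hv : v ∈ U) (hvw : v ≠ w) :
    Disjoint (openFacet U g v) (openFacet U g w) := by
  rw [Set.disjoint_left]
  rintro z ⟨h1, -⟩ ⟨-, h2⟩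
  exact (h2 v (Finset.mem_erase.mpr ⟨hvw, hv⟩)).ne h1

/-- On the facet the quotient for v would have denominator 0, so v must be erased; an inward ray
respects that constraint anyway. -/
theorem radialFun_eq_inv_of_inward {v u : S n} {z : E n}
    (hz : z ∈ openFacet U g v) (hu : u ∈ inwardDirections v)
    (hpos : 0 < invRadial (U.erase v) g z u) :
    radialFun (closedPoly U g) z u = (invRadial (U.erase v) g z u).toReal⁻¹ := by
  set r := invRadial (U.erase v) g z u with hr
  have hrtop : r ≠ ⊤ := (invRadial_lt_top _ _ _ _).ne
  have hrpos : 0 < r.toReal := ENNReal.toReal_pos hpos.ne' hrtop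
  have hset : {t : ℝ | 0 ≤ t ∧ z + t • (u : E n) ∈ closedPoly U g} = Set.Icc 0 r.toReal⁻¹ := by
    ext t
    simp only [Set.mem_ofPred_eq, Set.mem_Icc]
    refine and_congr_right fun ht => ?_
    rcases ht.eq_or_lt with rfl | ht0
    · simp only [zero_smul, add_zero]
      exact ⟨fun _ => by positivity, fun _ => openFacet_subset_closedPoly U g v hz⟩
    rw [le_inv_comm₀ ht0 hrpos, ← ENNReal.le_ofReal_iff_toReal_le hrtop (by positivity), hr,
      invRadial, Finset.sup_le_iff]
    have hiff : ∀ w ∈ U.erase v, (ENNReal.ofReal (inner ℝ (u : E n) (w : E n) /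
        (g w - inner ℝ z (w : E n))) ≤ ENNReal.ofReal t⁻¹ ↔
        inner ℝ (z + t • (u : E n)) (w : E n) ≤ g w) := by
      intro w hw
      rw [ENNReal.ofReal_le_ofReal_iff (by positivity), div_le_iff₀ (sub_pos.mpr (hz.2 w hw)),
        inner_add_left, inner_smul_left, conj_trivial, ← div_eq_inv_mul, le_div_iff₀' ht0,
        le_sub_iff_add_le']
    constructor
    · exact fun h w hw => (hiff w hw).mpr (h w (Finset.mem_of_mem_erase hw))
    · intro h w hw
      rcases eq_or_ne w v with rfl | hwv
      · rw [inner_add_left, inner_smul_left, conj_trivial, hz.1]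
        nlinarith [mem_inwardDirections.mp hu]
      · have hw' := Finset.mem_erase.mpr ⟨hwv, hw⟩
        exact (hiff w hw').mp (h w hw')
  rw [radialFun, hset, csSup_Icc (by positivity)]

theorem radialFun_eq_zero_of_outward {v u : S n} (hv : v ∈ U) {z : E n}
    (hz : z ∈ openFacet U g v) (hu : 0 < inner ℝ (u : E n) (v : E n)) :
    radialFun (closedPoly U g) z u = 0 := by
  have hset : {t : ℝ | 0 ≤ t ∧ z + t • (u : E n) ∈ closedPoly U g} = {0} := by
    ext t
    simp only [Set.mem_ofPred_eq, Set.mem_singleton_iff]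
    constructor
    · rintro ⟨ht, hmem⟩
      have h1 := hmem v hv
      rw [inner_add_left, inner_smul_left, conj_trivial, hz.1] at h1
      by_contra hne
      have : 0 < t := lt_of_le_of_ne ht (Ne.symm hne)
      nlinarith [mul_pos this hu]
    · rintro rfl
      refine ⟨le_rfl, ?_⟩
      rw [zero_smul, add_zero]
      exact openFacet_subset_closedPoly U g v hz
  rw [radialFun, hset, csSup_singleton]

theorem invRadial_erase_pos (hU : InGeneralPosition U) {v u : S n} {z : E n}
    (hz : z ∈ openPoly (U.erase v) g) (hu : u ∈ inwardDirections v) :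
    0 < invRadial (U.erase v) g z u := by
  obtain ⟨w, hw, hpos⟩ := hU.exists_inner_pos u
  have hwv : w ∈ U.erase v := by
    refine Finset.mem_erase.mpr ⟨?_, hw⟩
    rintro rfl
    exact absurd (mem_inwardDirections.mp hu) hpos.not_gt
  refine lt_of_lt_of_le ?_ (Finset.le_sup (f := fun w : S n =>
    ENNReal.ofReal (inner ℝ (u : E n) (w : E n) / (g w - inner ℝ z (w : E n)))) hwv)
  rw [ENNReal.ofReal_pos]
  exact div_pos hpos (sub_pos.mpr (hz w hwv))

/-- From a facet point the radial function is positive in inward directions and zero in outward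
ones; tangential directions form a null set. -/
theorem dualQuermassintegral_closedPoly (hU : InGeneralPosition U) {v : S n} (hv : v ∈ U)
    {z : E n} (hz : z ∈ openFacet U g v) (q : ℝ) :
    dualQuermassintegral (q - 1) (closedPoly U g) z =
      (n : ℝ≥0∞)⁻¹ * inwardIntegral (U.erase v) v q g z := by
  have hrad : ∀ u ∈ inwardDirections v, radialFun (closedPoly U g) z u =
      (invRadial (U.erase v) g z u).toReal⁻¹ := fun u hu =>
    radialFun_eq_inv_of_inward hz hu (invRadial_erase_pos hU hz.2 hu)
  have hpos : ∀ u ∈ inwardDirections v, 0 < (invRadial (U.erase v) g z u).toReal := fun u hu =>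
    ENNReal.toReal_pos (invRadial_erase_pos hU hz.2 hu).ne' (invRadial_lt_top _ _ _ _).ne
  unfold dualQuermassintegral inwardIntegral
  congr 1
  have hae : {u : S n | 0 < radialFun (closedPoly U g) z u}
      =ᵐ[(volume : Measure (E n)).toSphere] inwardDirections v := by
    have hz' : ∀ᵐ u : S n ∂(volume : Measure (E n)).toSphere,
        inner ℝ (u : E n) (v : E n) ≠ 0 := by
      rw [ae_iff]; simpa using toSphere_inner_eq_zero v
    filter_upwards [hz'] with u hu
    apply propext
    change 0 < radialFun (closedPoly U g) z u ↔ u ∈ inwardDirections v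
    constructor
    · intro h
      by_contra hnot
      have h1 : 0 < inner ℝ (u : E n) (v : E n) :=
        lt_of_le_of_ne (not_lt.mp hnot) (Ne.symm hu)
      rw [radialFun_eq_zero_of_outward hv hz h1] at h
      exact lt_irrefl _ h
    · intro h
      rw [hrad u h]
      exact inv_pos.mpr (hpos u h)
  rw [setLIntegral_congr hae]
  refine setLIntegral_congr_fun (measurableSet_inwardDirections v) fun u hu => ?_
  rw [hrad u hu, Real.inv_rpow (hpos u hu).le, ← Real.rpow_neg (hpos u hu).le, neg_sub,
    ← ENNReal.ofReal_rpow_of_pos (hpos u hu), ENNReal.ofReal_toReal (invRadial_lt_top _ _ _ _).ne]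

/-- Integration over a facet with respect to Hausdorff measure. -/
theorem setLIntegral_openFacet (U : Finset (S n)) (v : S n) (q : ℝ) (g : S n → ℝ) :
    ∫⁻ z in openFacet U g v, inwardIntegral (U.erase v) v q g z
      ∂(Measure.euclideanHausdorffMeasure (n - 1)) =
      sliceIntegral (U.erase v) v q g (g v) := by
  -- An isometric parametrization of the hyperplane of the facet; it carries Lebesgue measure to (n
  -- - 1)-dimensional Hausdorff measure, in the Euclidean normalization.
  set ι : (Submodule.span ℝ {(v : E n)})ᗮ → E n := fun y => g v • (v : E n) + y with hι
  have hiso : Isometry ι := by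
    intro x y
    rw [hι, edist_add_left]
    rfl
  have hιm : Measurable ι := hiso.continuous.measurable
  have hrank : Module.finrank ℝ (Submodule.span ℝ {(v : E n)})ᗮ = n - 1 := by
    have h1 := (Submodule.span ℝ {(v : E n)}).finrank_add_finrank_orthogonal
    rw [finrank_span_singleton (ne_zero_of_mem_unit_sphere v), finrank_euclideanSpace_fin] at h1
    omega
  have hmap := hiso.map_euclideanHausdorffMeasure (d := n - 1)
  have hvol : (Measure.euclideanHausdorffMeasure (n - 1) :
      Measure (Submodule.span ℝ {(v : E n)})ᗮ) = volume := by
    rw [← hrank]; exact InnerProductSpace.euclideanHausdorffMeasure_eq_volume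
  rw [hvol] at hmap
  have hset : openFacet U g v = openPoly (U.erase v) g ∩ Set.range ι := by
    ext z
    constructor
    · rintro ⟨h1, h2⟩
      refine ⟨h2, ⟨z - g v • (v : E n), ?_⟩, ?_⟩
      · rw [Submodule.mem_orthogonal_singleton_iff_inner_left, inner_sub_left, inner_smul_left,
          inner_sphere_self, h1]
        simp
      · simp [hι]
    · rintro ⟨h2, ⟨y, rfl⟩⟩
      refine ⟨?_, h2⟩
      have hyv : inner ℝ (y : E n) (v : E n) = 0 :=
        (Submodule.mem_orthogonal_singleton_iff_inner_left).mp y.2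
      rw [hι, inner_smul_add_orthogonal, hyv, inner_sphere_self]
      simp
  rw [hset, ← Measure.restrict_restrict (measurableSet_openPoly _ _), ← hmap,
    ← lintegral_indicator (measurableSet_openPoly _ _),
    lintegral_map ((measurable_inwardIntegral _ _ _ _).indicator (measurableSet_openPoly _ _)) hιm]
  rfl

/-- The `L_p` chord measure of a polytope. -/
theorem InGeneralPosition.lpChordMeasure_closedPoly (hn : 1 ≤ n) (hU : InGeneralPosition U)
    (g : S n → ℝ) (p q : ℝ) (η : Set (S n)) :
    lpChordMeasure p q (closedPoly U g) η = ∑ v ∈ U.filter (· ∈ η),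
      ENNReal.ofReal (2 * q) / volume (ball (0 : E n) 1) * (n : ℝ≥0∞)⁻¹ *
        (ENNReal.ofReal (g v ^ (1 - p)) * sliceIntegral (U.erase v) v q g (g v)) := by
  rw [lpChordMeasure, hU.gaussPreimage_closedPoly hn, lintegral_biUnion_finset, Finset.mul_sum]
  · refine Finset.sum_congr rfl fun v hv => ?_
    have hvU := (Finset.mem_filter.mp hv).1
    have hcongr : ∀ z ∈ openFacet U g v,
        ENNReal.ofReal ((inner ℝ z (gaussMap (closedPoly U g) z)) ^ (1 - p)) *
          dualQuermassintegral (q - 1) (closedPoly U g) z =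
        (ENNReal.ofReal (g v ^ (1 - p)) * (n : ℝ≥0∞)⁻¹) *
          inwardIntegral (U.erase v) v q g z := by
      intro z hz
      rw [gaussMap_eq_of_normals_eq (hU.normals_eq_of_mem_openFacet hn hvU hz), hz.1,
        dualQuermassintegral_closedPoly hU hvU hz, mul_assoc]
    rw [setLIntegral_congr_fun (measurableSet_openFacet U g v) hcongr,
      lintegral_const_mul _ (measurable_inwardIntegral _ _ _ _), setLIntegral_openFacet]
    ring
  · intro v hv w _ hvw
    exact disjoint_openFacet (Finset.mem_filter.mp hv).1 hvw
  · exact fun v _ => measurableSet_openFacet U g v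

end Geometry

end ChordMinkowski

end

theorem theorem1p1 (n : ℕ) (hn : 1 ≤ n) (p q : ℝ) (hp : p < 0) (hq : 0 < q)
    (U : Finset (ChordMinkowski.S n)) (hU : ChordMinkowski.InGeneralPosition U)
    (α : ChordMinkowski.S n → ℝ) (hα : ∀ v ∈ U, 0 < α v)
    (μ : Measure (ChordMinkowski.S n))
    (hμ : μ = ∑ v ∈ U, ENNReal.ofReal (α v) • Measure.dirac v) :
    ∃ P : Set (ChordMinkowski.E n),
      P ∈ ChordMinkowski.polytopeClass U ∧
      (0 : ChordMinkowski.E n) ∈ interior P ∧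
      (∀ v, ChordMinkowski.IsFacetNormal P v → v ∈ U) ∧
      ∀ η : Set (ChordMinkowski.S n), MeasurableSet η →
        ChordMinkowski.lpChordMeasure p q P η = μ η := by
  classical
  have hball : volume (ball (0 : ChordMinkowski.E n) 1) ≠ 0 :=
    (measure_ball_pos _ _ one_pos).ne'
  have hC0 : ENNReal.ofReal (2 * q) / volume (ball (0 : ChordMinkowski.E n) 1) *
      (n : ℝ≥0∞)⁻¹ ≠ 0 := by
    refine mul_ne_zero (ENNReal.div_ne_zero.mpr ⟨?_, measure_ball_lt_top.ne⟩) ?_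
    · simpa using hq
    · simp
  have hC : ENNReal.ofReal (2 * q) / volume (ball (0 : ChordMinkowski.E n) 1) *
      (n : ℝ≥0∞)⁻¹ ≠ ⊤ := by
    refine ENNReal.mul_ne_top (ENNReal.div_ne_top ENNReal.ofReal_ne_top hball) ?_
    simp; omega
  obtain ⟨g, hg, heq⟩ := hU.exists_sliceIntegral_eq hn hp hq hα hC0 hC
  refine ⟨ChordMinkowski.closedPoly U g, hU.closedPoly_mem_polytopeClass hn hg,
    ChordMinkowski.openPoly_subset_interior U g (ChordMinkowski.zero_mem_openPoly hg),
    fun v hv => hU.mem_of_isFacetNormal hn hg hv, fun η hη => ?_⟩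
  rw [hU.lpChordMeasure_closedPoly hn, hμ, Measure.finsetSum_apply, Finset.sum_filter]
  refine Finset.sum_congr rfl fun v hv => ?_
  rw [Measure.smul_apply, Measure.dirac_apply' _ hη, smul_eq_mul]
  by_cases hvη : v ∈ η
  · rw [if_pos hvη, Set.indicator_of_mem hvη, Pi.one_apply, mul_one]
    convert heq v hv
  · rw [if_neg hvη, Set.indicator_of_notMem hvη, mul_zero]
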